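/- Let $A$ be a quantum system with Hilbert space $\mathbb C^d$, $1\le d<\infty$, and fixed orthonormal (incoherent) basis $\{|i\rangle\}_{i}$. Let $\Delta(X)=\sum_i\langle i|X|i\rangle\,|i\rangle\langle i|$ be the dephasing channel; a composite system is given the product basis. A quantum channel is a completely positive trace-preserving linear map; it is unital if it fixes the identity operator. A channel $\mathcal F$ on $A$ is a detection-incoherent operation ($\mathcal F\in\mathbf{DIO}$) if $\Delta\circ\mathcal F=\Delta\circ\mathcal F\circ\Delta$. A measurement (POVM) $\mathcal M=\{M_x\}_{x=0}^{n-1}$, $M_x\ge 0$, $\sum_x M_x=I$, is incoherent ($\mathcal M\in\mathbf{IM}$) if $\Delta(M_x)=M_x$ for all $x$. For a channel $\mathcal E$, $\mathcal M\circ\mathcal E$ denotes the measurement $\{\mathcal E^\dagger(M_x)\}_x$, where $\operatorname{tr}(\mathcal E^\dagger(X)\rho)=\operatorname{tr}(X\mathcal E(\rho))$. For positive semidefinite $X,Y$ put $D(X\|Y)=\operatorname{tr}X\log X-\operatorname{tr}X\log Y$ (natural logarithm) if $\operatorname{supp}X\subseteq\operatorname{supp}Y$ and $D(X\|Y)=+\infty$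 otherwise. For two measurements with $n$ outcomes on a system of dimension $D_0$ put $D_m(\mathcal M\|\mathcal N)=\frac1{D_0}\sum_{x=0}^{n-1}D(M_x\|N_x)$. The measurement-cohering power of a channel $\mathcal E$ on $A$ is $$C(\mathcal E)=\min_{\mathcal F\in\mathbf{DIO}}\ \max_{\mathcal M\in\mathbf{IM}(A\widetilde A)} D_m\big(\mathcal M\circ(\mathcal E\otimes\mathrm{id}_{\widetilde A})\,\big\|\,\mathcal M\circ(\mathcal F\otimes\mathrm{id}_{\widetilde A})\big),$$ where the maximum is over incoherent measurements, with any finite number of outcomes, on $A\widetilde A$ for an ancilla $\widetilde A$ of any finite dimension $\ge1$. Theorem. $C$ is well defined (for every channel $\mathcal E$ the minimum, and for every $\mathcal F\in\mathbf{DIO}$ the maximum, is attained, and $C(\mathcal E)<\infty$), and it is a resource monotone: 1. (Non-negativity and faithfulness) For every channel $\mathcal E$ on $A$, $C(\mathcal E)\ge 0$, and $C(\mathcal E)=0$ if and only if $\mathcal E\in\mathbf{DIO}$. 2. (Monotonicity) For every channel $\mathcal E$, every $\mathcal K\in\mathbf{DIO}$ and every unital $\mathcal L\in\mathbf{DIO}$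 on $A$, $C(\mathcal K\circ\mathcal E\circ\mathcal L)\le C(\mathcal E)$. 3. (Convexity) For all channels $\mathcal E,\mathcal G$ on $A$ and $0\le p\le1$, $C(p\mathcal E+(1-p)\mathcal G)\le p\,C(\mathcal E)+(1-p)\,C(\mathcal G)$. -/

import Mathlib

open scoped Matrix ComplexOrder

noncomputable section

namespace MeasurementCohering

/-- Linear maps from operators on `ℂ^A` to operators on `ℂ^B`; the standard basis labelled by the
index type is the incoherent basis. -/
abbrev SuperOp (A B : Type*) := Matrix A A ℂ →ₗ[ℂ] Matrix B B ℂ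

/-- `E ⊗ id_R`, applying `E` to the first tensor factor and the identity to the second. -/
def ampliate {A B : Type*} (R : Type*) (E : SuperOp A B) : SuperOp (A × R) (B × R) where
  toFun X := Matrix.of fun p q => E (Matrix.of fun i j => X (i, p.2) (j, q.2)) p.1 q.1
  map_add' X Y := by
    ext p q
    exact congrFun (congrFun (map_add E (Matrix.of fun i j => X (i, p.2) (j, q.2))
      (Matrix.of fun i j => Y (i, p.2) (j, q.2))) p.1) q.1
  map_smul' c X := by
    ext p q
    exact congrFun (congrFun (map_smul E c (Matrix.of fun i j => X (i, p.2) (j, q.2))) p.1) q.1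

/-- Complete positivity: `E ⊗ id_k` is positive for every finite dimension `k`. -/
def IsCompletelyPositive {A B : Type*} (E : SuperOp A B) : Prop :=
  ∀ (k : ℕ) (X : Matrix (A × Fin k) (A × Fin k) ℂ),
    X.PosSemidef → (ampliate (Fin k) E X).PosSemidef

/-- A quantum channel: a completely positive trace-preserving linear map. -/
structure IsChannel {A B : Type*} [Fintype A] [Fintype B] (E : SuperOp A B) : Prop where
  completelyPositive : IsCompletelyPositive E
  trace_preserving : ∀ X : Matrix A A ℂ, (E X).trace = X.trace

/-- A map is unital if it sends the identity operator to the identity operator. -/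
def IsUnital {A B : Type*} [DecidableEq A] [DecidableEq B] (E : SuperOp A B) : Prop :=
  E 1 = 1

/-- The adjoint (Heisenberg-picture) map `E†`, given by `⟨i|E†(X)|j⟩ = tr (X E(|j⟩⟨i|))`; it is
characterised by `tr (E†(X) ρ) = tr (X E(ρ))`, see `trace_dual_mul`. -/
def dual {A B : Type*} [DecidableEq A] [Fintype B] (E : SuperOp A B) : SuperOp B A where
  toFun X := Matrix.of fun i j => (X * E (Matrix.single j i 1)).trace
  map_add' X Y := by
    ext i j
    simp [add_mul]
  map_smul' c X := by
    ext i j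
    simp

theorem trace_dual_mul {A B : Type*} [Fintype A] [DecidableEq A] [Fintype B] (E : SuperOp A B)
    (X : Matrix B B ℂ) (ρ : Matrix A A ℂ) :
    (dual E X * ρ).trace = (X * E ρ).trace := by
  conv_rhs => rw [Matrix.matrix_eq_sum_single ρ]
  simp only [map_sum, Finset.mul_sum, Matrix.trace_sum]
  rw [Finset.sum_comm]
  simp only [Matrix.trace, Matrix.diag, Matrix.mul_apply, dual, LinearMap.coe_mk, AddHom.coe_mk,
    Matrix.of_apply]
  refine Finset.sum_congr rfl fun i _ => Finset.sum_congr rfl fun j _ => ?_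
  have h : Matrix.single j i (ρ j i) = ρ j i • Matrix.single j i (1 : ℂ) := by simp
  rw [h, map_smul, Finset.sum_mul]
  refine Finset.sum_congr rfl fun a _ => ?_
  rw [Finset.sum_mul]
  refine Finset.sum_congr rfl fun b _ => ?_
  simp only [Matrix.smul_apply, smul_eq_mul]
  ring

/-- The completely dephasing map `Δ(X) = ∑ i, ⟨i|X|i⟩ |i⟩⟨i|` in the incoherent basis. -/
def dephase (A : Type*) [DecidableEq A] : SuperOp A A where
  toFun X := Matrix.diagonal X.diag
  map_add' X Y := by simp [Matrix.diagonal_add]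
  map_smul' c X := by simp [Matrix.diagonal_smul]

/-- Detection-incoherent operations: channels with `Δ ∘ E = Δ ∘ E ∘ Δ`. -/
structure IsDIO {A : Type*} [Fintype A] [DecidableEq A] (E : SuperOp A A) : Prop where
  isChannel : IsChannel E
  detection_incoherent : dephase A ∘ₗ E = dephase A ∘ₗ E ∘ₗ dephase A

/-- A quantum measurement with `n` outcomes (a POVM). -/
structure IsMeasurement {A : Type*} [DecidableEq A] {n : ℕ}
    (M : Fin n → Matrix A A ℂ) : Prop where
  posSemidef : ∀ x, (M x).PosSemidef
  sum_eq_one : ∑ x, M x = 1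

/-- An incoherent measurement: all POVM elements are fixed by dephasing. -/
structure IsIncoherentMeasurement {A : Type*} [DecidableEq A] {n : ℕ}
    (M : Fin n → Matrix A A ℂ) : Prop where
  isMeasurement : IsMeasurement M
  incoherent : ∀ x, dephase A (M x) = M x

/-- The measurement `M ∘ E` (apply `E`, then measure `M`), whose POVM elements are `E†(M x)`. -/
def preProcess {A B : Type*} [DecidableEq A] [Fintype B] {n : ℕ}
    (M : Fin n → Matrix B B ℂ) (E : SuperOp A B) : Fin n → Matrix A A ℂ :=
  fun x => dual E (M x)

open Classical in
/-- Quantum relative entropy `D(X‖Y) = tr (X log X) - tr (X log Y)` of positive semidefinite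
matrices (not necessarily of unit trace) if `supp X ⊆ supp Y`, equivalently `ker Y ⊆ ker X`, and
`+∞` otherwise. Since `Real.log 0 = 0`, `cfc Real.log` is the logarithm on the support. -/
def relEntropy {A : Type*} [Fintype A] [DecidableEq A] (X Y : Matrix A A ℂ) : EReal :=
  if ∀ v : A → ℂ, Y *ᵥ v = 0 → X *ᵥ v = 0 then
    (((X * cfc Real.log X).trace - (X * cfc Real.log Y).trace).re : EReal)
  else ⊤

/-- Measurement relative entropy `D_m(M‖N) = (1/d) ∑ x, D(M x‖N x)`, with `d` the dimension of the
measured system. -/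
def measRelEntropy {A : Type*} [Fintype A] [DecidableEq A] {n : ℕ}
    (M N : Fin n → Matrix A A ℂ) : EReal :=
  ((1 / (Fintype.card A : ℝ) : ℝ) : EReal) * ∑ x, relEntropy (M x) (N x)

/-- `D_m(M ∘ E ‖ M ∘ F)` for a measurement `M` on the system and an ancilla `R` on which the
channels act trivially. -/
def measDivergence {A R : Type*} [Fintype A] [DecidableEq A] [Fintype R] [DecidableEq R] {n : ℕ}
    (M : Fin n → Matrix (A × R) (A × R) ℂ) (E F : SuperOp A A) : EReal :=
  measRelEntropy (preProcess M (ampliate R E)) (preProcess M (ampliate R F))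

/-- The maximum of `D_m(M ∘ E ‖ M ∘ F)` over all incoherent measurements `M`, with any number of
outcomes, on the system together with an ancilla of any dimension `k + 1 ≥ 1`. -/
def maxDivergence {A : Type*} [Fintype A] [DecidableEq A] (E F : SuperOp A A) : EReal :=
  ⨆ (k : ℕ) (n : ℕ) (M : Fin n → Matrix (A × Fin (k + 1)) (A × Fin (k + 1)) ℂ)
    (_ : IsIncoherentMeasurement M), measDivergence M E F

/-- The measurement-cohering power: the minimum over detection-incoherent `F` of
`maxDivergence E F`. -/
def coheringPower {A : Type*} [Fintype A] [DecidableEq A] (E : SuperOp A A) : EReal :=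
  ⨅ (F : SuperOp A A) (_ : IsDIO F), maxDivergence E F

end MeasurementCohering

end

/-! The proof computes $C(\mathcal E)$ in closed form. Let $E_i=\mathcal E^\dagger(|i\rangle\langle
i|)$ be the basis effects. A channel $\mathcal F$ is detection-incoherent exactly when its effects
$F_i$ are diagonal, and these are then the rows of a column-stochastic matrix $f$.

Maximum: an incoherent POVM is a stochastic post-processing of the product basis measurement, whose
effects after $\mathcal E\otimes\mathrm{id}$ are $E_i\otimes|r\rangle\langle r|$. Joint convexity
and homogeneity of $D$ make the basis measurement optimal. The ancilla only multiplies the sum by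
its dimension, which the normalisation cancels (`maxDivergence_eq`).

Minimum: $D(E_i\|F_i)$ involves $f$ only through $-\sum_j (E_i)_{jj}\log f_{ij}$. Gibbs' inequality
in each column selects $f_{ij}=(E_i)_{jj}$, realised by $\Delta\circ\mathcal E\circ\Delta$. Hence
$C(\mathcal E)=\frac1d\sum_i D(E_i\|\Delta(E_i))$ (`coheringPower_eq`).

Faithfulness is the equality case of Jensen's inequality for $x\log x$, and convexity is joint
convexity of $D$. For monotonicity, the effects of $\mathcal K\circ\mathcal E\circ\mathcal L$ are
the mixtures $\sum_j k_{ij}\mathcal L^\dagger(E_j)$, handled by joint convexity and data processing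
under $\mathcal L^\dagger$.

Both properties of $D$ are needed only for a diagonal second argument. They come from writing $D$ as
an integral over $t\in(0,1)$ of a kernel that is, up to affine normalisation, a supremum over $Z$ of
forms linear in $(X,Y)$ (`exists_kernel`). Linearity in $(X,Y)$ gives joint convexity. The
Kadison–Schwarz inequality gives data processing, with $\mathcal L(Z)$ as the new test operator. -/

noncomputable section

namespace MeasurementCohering

open Matrix

/-! ### Diagonalizations and relative entropy to a diagonal operator -/

/-- A diagonalization `X = U diag(l) Uᴴ` with `U` unitary. -/
structure IsDiagonalization {A : Type*} [Fintype A] [DecidableEq A] (X U : Matrix A A ℂ)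
    (l : A → ℝ) : Prop where
  star_mul : Uᴴ * U = 1
  mul_star : U * Uᴴ = 1
  eq : X = U * diagonal (fun a => (l a : ℂ)) * Uᴴ

theorem exists_isDiagonalization {A : Type*} [Fintype A] [DecidableEq A] {X : Matrix A A ℂ}
    (hX : X.PosSemidef) : ∃ U l, IsDiagonalization X U l ∧ (∀ a, 0 ≤ l a) := by
  refine ⟨hX.1.eigenvectorUnitary, hX.1.eigenvalues, ⟨?_, ?_, ?_⟩, hX.eigenvalues_nonneg⟩
  · exact Unitary.coe_star_mul_self _
  · exact Unitary.coe_mul_star_self _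
  · conv_lhs => rw [hX.1.spectral_theorem, Unitary.conjStarAlgAut_apply]
    rfl

theorem IsDiagonalization.isHermitian {A : Type*} [Fintype A] [DecidableEq A]
    {X U : Matrix A A ℂ} {l : A → ℝ} (h : IsDiagonalization X U l) : X.IsHermitian := by
  rw [h.eq]
  refine isHermitian_mul_mul_conjTranspose _ ?_
  exact isHermitian_diagonal_of_self_adjoint _ (by ext; simp)

/-- The functional calculus is defined through one chosen eigenbasis $V$. The unitary $V^*U$
intertwines the two eigenvalue lists, so its nonzero entries join only equal eigenvalues. It
therefore intertwines the lists after applying $f$ as well. -/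
theorem IsDiagonalization.cfc_eq {A : Type*} [Fintype A] [DecidableEq A]
    {X U : Matrix A A ℂ} {l : A → ℝ} (h : IsDiagonalization X U l) (f : ℝ → ℝ) :
    cfc f X = U * diagonal (fun a => (f (l a) : ℂ)) * Uᴴ := by
  have hX := h.isHermitian
  rw [hX.cfc_eq, IsHermitian.cfc, Unitary.conjStarAlgAut_apply]
  have hs := hX.spectral_theorem
  rw [Unitary.conjStarAlgAut_apply] at hs
  set V : Matrix A A ℂ := (hX.eigenvectorUnitary : Matrix A A ℂ) with hV
  set μ := hX.eigenvalues with hμ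
  have hV1 : star V * V = 1 := Unitary.coe_star_mul_self _
  have hV2 : V * star V = 1 := Unitary.coe_mul_star_self _
  have key : diagonal (fun a => (μ a : ℂ)) * (star V * U)
      = (star V * U) * diagonal (fun a => (l a : ℂ)) := by
    have h1 : star V * X * U = diagonal (fun a => (μ a : ℂ)) * (star V * U) := by
      conv_lhs => rw [hs]
      simp only [← mul_assoc, hV1, one_mul]
      rfl
    have h2 : star V * X * U = (star V * U) * diagonal (fun a => (l a : ℂ)) := by
      conv_lhs => rw [h.eq]
      simp only [mul_assoc, h.star_mul, mul_one]
    rw [← h1, h2]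
  have key2 : diagonal (fun a => (f (μ a) : ℂ)) * (star V * U)
      = (star V * U) * diagonal (fun a => (f (l a) : ℂ)) := by
    ext a b
    have := congrFun (congrFun key a) b
    rw [diagonal_mul, mul_diagonal] at this ⊢
    by_cases h0 : (star V * U) a b = 0
    · simp [h0]
    · have : μ a = l b := by
        rw [mul_comm] at this
        exact_mod_cast mul_left_cancel₀ h0 this
      rw [this, mul_comm]
  have : V * (diagonal (fun a => (f (μ a) : ℂ)) * (star V * U)) * Uᴴ
      = V * ((star V * U) * diagonal (fun a => (f (l a) : ℂ))) * Uᴴ := by rw [key2]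
  simp only [mul_assoc, h.mul_star, mul_one] at this
  rw [← mul_assoc V (star V), hV2, one_mul] at this
  rw [mul_assoc, mul_assoc]
  exact this

theorem isDiagonalization_diagonal {A : Type*} [Fintype A] [DecidableEq A] (y : A → ℝ) :
    IsDiagonalization (diagonal fun a => (y a : ℂ)) 1 y :=
  ⟨by simp, by simp, by simp⟩

/-- The negative von Neumann entropy `tr (X log X)`. -/
def negEntropy {A : Type*} [Fintype A] [DecidableEq A] (X : Matrix A A ℂ) : ℝ :=
  ((X * cfc Real.log X).trace).re

/-- The value `tr (X log X) - tr (X log Y)` for `Y = diag(y)`. -/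
def relDiag {A : Type*} [Fintype A] [DecidableEq A] (X : Matrix A A ℂ) (y : A → ℝ) : ℝ :=
  negEntropy X - ∑ j, (X j j).re * Real.log (y j)

theorem IsDiagonalization.negEntropy_eq {A : Type*} [Fintype A] [DecidableEq A]
    {X U : Matrix A A ℂ} {l : A → ℝ} (h : IsDiagonalization X U l) :
    negEntropy X = ∑ a, l a * Real.log (l a) := by
  rw [negEntropy, h.cfc_eq]
  have : X * (U * diagonal (fun a => (Real.log (l a) : ℂ)) * Uᴴ)
      = U * diagonal (fun a => ((l a * Real.log (l a) : ℝ) : ℂ)) * Uᴴ := by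
    conv_lhs => rw [h.eq]
    calc _ = U * diagonal (fun a => (l a : ℂ)) * (Uᴴ * U) *
          diagonal (fun a => (Real.log (l a) : ℂ)) * Uᴴ := by simp only [mul_assoc]
      _ = _ := by
        rw [h.star_mul, mul_one, mul_assoc U, diagonal_mul_diagonal]
        simp
  rw [this, trace_mul_comm, ← mul_assoc, h.star_mul, one_mul, trace_diagonal]
  simp only [Complex.re_sum, Complex.ofReal_re]

theorem IsDiagonalization.apply_eq {A : Type*} [Fintype A] [DecidableEq A]
    {X U : Matrix A A ℂ} {l : A → ℝ} (h : IsDiagonalization X U l) (i j : A) :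
    X i j = ∑ a, U i a * l a * star (U j a) := by
  conv_lhs => rw [h.eq]
  rw [mul_apply]
  simp [mul_diagonal]

theorem IsDiagonalization.diag_re {A : Type*} [Fintype A] [DecidableEq A]
    {X U : Matrix A A ℂ} {l : A → ℝ} (h : IsDiagonalization X U l) (j : A) :
    (X j j).re = ∑ a, Complex.normSq (U j a) * l a := by
  rw [h.apply_eq, Complex.re_sum]
  refine Finset.sum_congr rfl fun a _ => ?_
  have : U j a * l a * star (U j a) = ((Complex.normSq (U j a) * l a : ℝ) : ℂ) := by
    push_cast
    rw [← Complex.mul_conj]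
    simp only [RCLike.star_def]; ring
  rw [this, Complex.ofReal_re]

theorem IsDiagonalization.sum_normSq_row {A : Type*} [Fintype A] [DecidableEq A]
    {X U : Matrix A A ℂ} {l : A → ℝ} (h : IsDiagonalization X U l) (j : A) :
    ∑ a, Complex.normSq (U j a) = 1 := by
  have := congrFun (congrFun h.mul_star j) j
  rw [mul_apply, one_apply_eq] at this
  have h2 : ∑ a, ((Complex.normSq (U j a) : ℝ) : ℂ) = 1 := by
    rw [← this]
    refine Finset.sum_congr rfl fun a _ => ?_
    rw [← Complex.mul_conj]; rfl
  exact_mod_cast h2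

theorem IsDiagonalization.sum_normSq_col {A : Type*} [Fintype A] [DecidableEq A]
    {X U : Matrix A A ℂ} {l : A → ℝ} (h : IsDiagonalization X U l) (a : A) :
    ∑ j, Complex.normSq (U j a) = 1 := by
  have := congrFun (congrFun h.star_mul a) a
  rw [mul_apply, one_apply_eq] at this
  have h2 : ∑ j, ((Complex.normSq (U j a) : ℝ) : ℂ) = 1 := by
    rw [← this]
    refine Finset.sum_congr rfl fun j _ => ?_
    rw [Complex.normSq_eq_conj_mul_self]; rfl
  exact_mod_cast h2

/-- Vanishing diagonal entries of a positive semidefinite matrix kill the column. -/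
theorem posSemidef_col_eq_zero {A : Type*} [Fintype A] [DecidableEq A] {X : Matrix A A ℂ}
    (hX : X.PosSemidef) {j : A} (h : X j j = 0) (i : A) : X i j = 0 := by
  obtain ⟨U, l, hU, hl⟩ := exists_isDiagonalization hX
  have h1 := hU.diag_re j
  rw [h, Complex.zero_re] at h1
  have h2 := (Finset.sum_eq_zero_iff_of_nonneg
    (fun a _ => mul_nonneg (Complex.normSq_nonneg _) (hl a))).1 h1.symm
  rw [hU.apply_eq]
  refine Finset.sum_eq_zero fun a ha => ?_
  rcases mul_eq_zero.1 (h2 a ha) with h3 | h3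
  · simp [Complex.normSq_eq_zero.1 h3]
  · simp [h3]

/-- The kernel of a diagonal matrix is spanned by basis vectors, and a positive semidefinite matrix
kills a basis vector once its diagonal entry there vanishes. The support condition thus reduces to
diagonal entries. -/
theorem relEntropy_diagonal {A : Type*} [Fintype A] [DecidableEq A] {X : Matrix A A ℂ}
    (hX : X.PosSemidef) (y : A → ℝ) :
    relEntropy X (diagonal fun a => (y a : ℂ)) =
      if ∀ j, y j = 0 → X j j = 0 then ((relDiag X y : ℝ) : EReal) else ⊤ := by
  have hc : (∀ v : A → ℂ, (diagonal fun a => (y a : ℂ)) *ᵥ v = 0 → X *ᵥ v = 0) ↔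
      ∀ j, y j = 0 → X j j = 0 := by
    constructor
    · intro h j hj
      have := h (Pi.single j 1) (by
        ext i
        rw [mulVec_diagonal]
        by_cases hij : i = j
        · subst hij; simp [hj]
        · simp [hij])
      have := congrFun this j
      simpa using this
    · intro h v hv
      ext i
      rw [mulVec, dotProduct]
      refine Finset.sum_eq_zero fun j _ => ?_
      have := congrFun hv j
      rw [mulVec_diagonal] at this
      rcases mul_eq_zero.1 this with h1 | h1
      · rw [posSemidef_col_eq_zero hX (h j (by exact_mod_cast h1)), zero_mul]
      · rw [h1, mul_zero]
  rw [relEntropy]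
  simp only [hc]
  congr 1
  rw [(isDiagonalization_diagonal y).cfc_eq, relDiag, negEntropy, Complex.sub_re]
  simp [trace, mul_diagonal]

theorem IsDiagonalization.kronecker {A R : Type*} [Fintype A] [DecidableEq A] [Fintype R]
    [DecidableEq R] {X U : Matrix A A ℂ} {l : A → ℝ} (h : IsDiagonalization X U l) (r : R) :
    IsDiagonalization (kroneckerMap (· * ·) X (single r r 1)) (kroneckerMap (· * ·) U 1)
      (fun p : A × R => if p.2 = r then l p.1 else 0) := by
  have hs : (kroneckerMap (· * ·) U (1 : Matrix R R ℂ))ᴴ = kroneckerMap (· * ·) Uᴴ 1 := by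
    rw [conjTranspose_kronecker, conjTranspose_one]
  refine ⟨?_, ?_, ?_⟩
  · rw [hs, ← mul_kronecker_mul, h.star_mul]; simp
  · rw [hs, ← mul_kronecker_mul, h.mul_star]; simp
  · have hd : diagonal (fun p : A × R => (((if p.2 = r then l p.1 else 0 : ℝ)) : ℂ)) =
        kroneckerMap (· * ·) (diagonal fun a => (l a : ℂ)) (single r r 1) := by
      ext p q
      rw [kroneckerMap_apply, diagonal_apply, diagonal_apply, single_apply]
      rcases p with ⟨p, s⟩
      rcases q with ⟨q, t⟩
      by_cases h1 : p = q <;> by_cases h2 : r = s <;> by_cases h3 : r = t <;>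
        simp_all [eq_comm (a := s)]
    rw [hd, hs, ← mul_kronecker_mul, ← mul_kronecker_mul, ← h.eq]
    simp

/-- Tensoring with a basis projector only adds zero eigenvalues and zero diagonal entries, which
contribute nothing to either sum. -/
theorem relDiag_kronecker {A R : Type*} [Fintype A] [DecidableEq A] [Fintype R]
    [DecidableEq R] {X : Matrix A A ℂ} (hX : X.PosSemidef) (y : A → ℝ) (r : R) :
    relDiag (kroneckerMap (· * ·) X (single r r 1)) (fun p : A × R => if p.2 = r then y p.1 else 0)
      = relDiag X y := by
  obtain ⟨U, l, hU, -⟩ := exists_isDiagonalization hX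
  rw [relDiag, relDiag, hU.negEntropy_eq, (hU.kronecker r).negEntropy_eq]
  rw [Fintype.sum_prod_type, Fintype.sum_prod_type]
  congr 1
  · refine Finset.sum_congr rfl fun a _ => ?_
    rw [Finset.sum_eq_single r] <;> simp +contextual
  · refine Finset.sum_congr rfl fun a _ => ?_
    rw [Finset.sum_eq_single r] <;> simp +contextual

/-! ### Integral and variational representation of the relative entropy -/

theorem integral_kernel_of_pos {l y : ℝ} (hl : 0 < l) (hy : 0 < y) :
    IntervalIntegrable (fun t => l * (l - y) / ((1 - t) * l + t * y)) MeasureTheory.volume 0 1 ∧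
      ∫ t in (0 : ℝ)..1, l * (l - y) / ((1 - t) * l + t * y) =
        l * (Real.log l - Real.log y) := by
  have hpos : ∀ t ∈ Set.uIcc (0 : ℝ) 1, 0 < (1 - t) * l + t * y := by
    intro t ht
    rw [Set.uIcc_of_le zero_le_one] at ht
    rcases eq_or_lt_of_le ht.1 with h | h
    · subst h; simpa
    · have := mul_pos h hy
      have := mul_nonneg (sub_nonneg.2 ht.2) hl.le
      linarith
  have hint : IntervalIntegrable (fun t => l * (l - y) / ((1 - t) * l + t * y))
      MeasureTheory.volume 0 1 := by
    refine ContinuousOn.intervalIntegrable ?_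
    exact ContinuousOn.div (by fun_prop) (by fun_prop) fun t ht => (hpos t ht).ne'
  refine ⟨hint, ?_⟩
  -- The antiderivative $-l\log((1-t)l+ty)$ equals $-l\log l$ at $0$ and $-l\log y$ at $1$.
  have hd : ∀ t ∈ Set.uIcc (0 : ℝ) 1,
      HasDerivAt (fun t => -(l * Real.log ((1 - t) * l + t * y)))
        (l * (l - y) / ((1 - t) * l + t * y)) t := by
    intro t ht
    have h1 : HasDerivAt (fun t : ℝ => (1 - t) * l + t * y) (-1 * l + 1 * y) t :=
      (((hasDerivAt_id t).const_sub 1).mul_const l).add ((hasDerivAt_id t).mul_const y)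
    have := ((h1.log (hpos t ht).ne').const_mul l).neg
    exact this.congr_deriv (by ring)
  rw [intervalIntegral.integral_eq_sub_of_hasDerivAt hd hint]
  simp
  ring

theorem intervalIntegrable_finsetSum {ι : Type*} [Fintype ι] {f : ι → ℝ → ℝ} {a b : ℝ}
    (h : ∀ i, IntervalIntegrable (f i) MeasureTheory.volume a b) :
    IntervalIntegrable (fun t => ∑ i, f i t) MeasureTheory.volume a b := by
  simpa only [Finset.sum_fn] using IntervalIntegrable.sum Finset.univ fun i _ => h i

/-- For $y=0<l$ the kernel is $l/(1-t)$, not integrable at $1$; the support hypothesis then forces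
the weight $w$ to vanish. -/
theorem integral_kernel_term {w l y : ℝ} (hl : 0 ≤ l) (hy : 0 ≤ y)
    (h : y = 0 → w * l = 0) :
    IntervalIntegrable (fun t => w * (l * (l - y) / ((1 - t) * l + t * y)))
        MeasureTheory.volume 0 1 ∧
      ∫ t in (0 : ℝ)..1, w * (l * (l - y) / ((1 - t) * l + t * y)) =
        w * (l * (Real.log l - Real.log y)) := by
  rcases eq_or_lt_of_le hl with rfl | hl
  · simp
  · rcases eq_or_lt_of_le hy with rfl | hy
    · have : w = 0 := by simpa [hl.ne'] using h rfl
      subst this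
      simp
    · obtain ⟨h1, h2⟩ := integral_kernel_of_pos hl hy
      exact ⟨h1.const_mul w, by rw [intervalIntegral.integral_const_mul, h2]⟩

/-- The functional `2 Re tr(XZ) - (1-t) tr(X ZᴴZ) - t tr(Y ZZᴴ)`. -/
def varForm {A : Type*} [Fintype A] (t : ℝ) (Z X Y : Matrix A A ℂ) : ℝ :=
  2 * (X * Z).trace.re - (1 - t) * (X * (Zᴴ * Z)).trace.re - t * (Y * (Z * Zᴴ)).trace.re

/-- In the eigenbasis of $X$ the form decouples into independent scalar quadratics in the entries of
$ZU$, so it can be maximised entry by entry. -/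
theorem IsDiagonalization.varForm_eq {A : Type*} [Fintype A] [DecidableEq A]
    {X U : Matrix A A ℂ} {l : A → ℝ} (h : IsDiagonalization X U l) (t : ℝ) (y : A → ℝ)
    (Z : Matrix A A ℂ) :
    varForm t Z X (diagonal fun a => (y a : ℂ)) =
      ∑ a, ∑ j, (2 * (l a * (star (U j a) * (Z * U) j a).re)
        - ((1 - t) * l a + t * y j) * Complex.normSq ((Z * U) j a)) := by
  have h1 : (X * Z).trace = ∑ a, ∑ j, (l a : ℂ) * (star (U j a) * (Z * U) j a) := by
    have : (X * Z).trace = (diagonal (fun a => (l a : ℂ)) * (Uᴴ * (Z * U))).trace := by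
      conv_lhs => rw [h.eq]
      rw [mul_assoc, mul_assoc, trace_mul_comm]
      simp only [mul_assoc]
    rw [this, trace]
    simp [diagonal_mul, Matrix.mul_apply (M := Uᴴ), Finset.mul_sum]
  have h2 : (X * (Zᴴ * Z)).trace = ∑ a, ∑ j, ((l a * Complex.normSq ((Z * U) j a) : ℝ) : ℂ) := by
    have : (X * (Zᴴ * Z)).trace =
        (diagonal (fun a => (l a : ℂ)) * ((Z * U)ᴴ * (Z * U))).trace := by
      conv_lhs => rw [h.eq]
      rw [mul_assoc, mul_assoc, trace_mul_comm, conjTranspose_mul]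
      simp only [mul_assoc]
    rw [this, trace]
    simp only [diag_apply, diagonal_mul, Matrix.mul_apply (M := (Z * U)ᴴ), Finset.mul_sum]
    refine Finset.sum_congr rfl fun a _ => Finset.sum_congr rfl fun j _ => ?_
    rw [Complex.ofReal_mul, Complex.normSq_eq_conj_mul_self]
    rfl
  have h3 : ((diagonal fun a => (y a : ℂ)) * (Z * Zᴴ)).trace =
      ∑ a, ∑ j, ((y j * Complex.normSq ((Z * U) j a) : ℝ) : ℂ) := by
    have : Z * Zᴴ = (Z * U) * (Z * U)ᴴ := by
      rw [conjTranspose_mul, mul_assoc, ← mul_assoc U, h.mul_star, one_mul]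
    rw [this, trace, Finset.sum_comm]
    simp only [diag_apply, diagonal_mul, Matrix.mul_apply (N := (Z * U)ᴴ), Finset.mul_sum]
    refine Finset.sum_congr rfl fun a _ => Finset.sum_congr rfl fun j _ => ?_
    rw [Complex.ofReal_mul, ← Complex.mul_conj]
    rfl
  rw [varForm, h1, h2, h3]
  simp only [Complex.re_sum, Complex.ofReal_re, Complex.re_ofReal_mul, Finset.mul_sum,
    ← Finset.sum_sub_distrib]
  refine Finset.sum_congr rfl fun a _ => Finset.sum_congr rfl fun j _ => ?_
  ring

theorem varForm_term_le {t l y : ℝ} (ht : 0 < t) (ht1 : t < 1) (hl : 0 ≤ l) (hy : 0 ≤ y)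
    (u w : ℂ) :
    2 * (l * (star u * w).re) - ((1 - t) * l + t * y) * Complex.normSq w ≤
      Complex.normSq u * l + t * (Complex.normSq u * (l * (l - y) / ((1 - t) * l + t * y))) := by
  have hc0 : 0 ≤ (1 - t) * l + t * y :=
    add_nonneg (mul_nonneg (sub_pos.2 ht1).le hl) (mul_nonneg ht.le hy)
  rcases eq_or_lt_of_le hc0 with hc | hc
  · have h1 : (1 - t) * l = 0 := by
      have := mul_nonneg (sub_pos.2 ht1).le hl
      have := mul_nonneg ht.le hy
      linarith
    have hl0 : l = 0 := by simpa [(sub_pos.2 ht1).ne'] using h1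
    rw [← hc, hl0]; simp
  · set c := (1 - t) * l + t * y with hcdef
    -- With $c=(1-t)l+ty$ one has $t(l-y)=l-c$, so the right side collapses to $|u|^2l^2/c$.
    have h1 : Complex.normSq u * l + t * (Complex.normSq u * (l * (l - y) / c)) =
        Complex.normSq u * l ^ 2 / c := by
      have : t * (l - y) = l - c := by rw [hcdef]; ring
      field_simp
      linear_combination Complex.normSq u * l * this
    rw [h1, le_div_iff₀ hc]
    -- Completing the square: $|lu-cw|^2\ge 0$, with equality at $w=(l/c)u$, the choice made in
    -- `varForm_term_eq`.
    have h2 : 0 ≤ (l * u.re - c * w.re) ^ 2 + (l * u.im - c * w.im) ^ 2 := by positivity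
    have h3 : (star u * w).re = u.re * w.re + u.im * w.im := by simp [Complex.mul_re]
    rw [h3, Complex.normSq_apply, Complex.normSq_apply]
    nlinarith [h2]

theorem varForm_term_eq {t l y : ℝ} (ht : 0 < t) (ht1 : t < 1) (hl : 0 ≤ l) (hy : 0 ≤ y)
    (u : ℂ) :
    2 * (l * (star u * (((l / ((1 - t) * l + t * y) : ℝ) : ℂ) * u)).re) -
        ((1 - t) * l + t * y) * Complex.normSq (((l / ((1 - t) * l + t * y) : ℝ) : ℂ) * u) =
      Complex.normSq u * l + t * (Complex.normSq u * (l * (l - y) / ((1 - t) * l + t * y))) := by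
  have hc0 : 0 ≤ (1 - t) * l + t * y :=
    add_nonneg (mul_nonneg (sub_pos.2 ht1).le hl) (mul_nonneg ht.le hy)
  rcases eq_or_lt_of_le hc0 with hc | hc
  · have h1 : (1 - t) * l = 0 := by
      have := mul_nonneg (sub_pos.2 ht1).le hl
      have := mul_nonneg ht.le hy
      linarith
    have hl0 : l = 0 := by simpa [(sub_pos.2 ht1).ne'] using h1
    rw [← hc, hl0]; simp
  · set c := (1 - t) * l + t * y with hcdef
    have h3 : (star u * (((l / c : ℝ) : ℂ) * u)).re = l / c * Complex.normSq u := by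
      have : star u * (((l / c : ℝ) : ℂ) * u) = ((l / c * Complex.normSq u : ℝ) : ℂ) := by
        rw [Complex.ofReal_mul, Complex.normSq_eq_conj_mul_self]
        simp only [RCLike.star_def]; ring
      rw [this, Complex.ofReal_re]
    rw [h3, Complex.normSq_mul, Complex.normSq_ofReal]
    have : t * (l - y) = l - c := by rw [hcdef]; ring
    field_simp
    linear_combination -Complex.normSq u * l * this

/-- `relDiag X y` is the integral over `(0, 1)` of a kernel which is, up to an affine
normalisation, the supremum of `varForm t Z X Y` over `Z`. -/
theorem exists_kernel {A : Type*} [Fintype A] [DecidableEq A] {X : Matrix A A ℂ}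
    (hX : X.PosSemidef) {y : A → ℝ} (hy : ∀ j, 0 ≤ y j) (hac : ∀ j, y j = 0 → X j j = 0) :
    ∃ h : ℝ → ℝ, IntervalIntegrable h MeasureTheory.volume 0 1 ∧
      ∫ t in (0 : ℝ)..1, h t = relDiag X y ∧
      ∀ t, 0 < t → t < 1 →
        (∀ Z, varForm t Z X (diagonal fun a => (y a : ℂ)) ≤ X.trace.re + t * h t) ∧
        ∃ Z, varForm t Z X (diagonal fun a => (y a : ℂ)) = X.trace.re + t * h t := by
  obtain ⟨U, l, hU, hl⟩ := exists_isDiagonalization hX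
  have hterm : ∀ a j, y j = 0 → Complex.normSq (U j a) * l a = 0 := by
    intro a j hj
    have h1 := hU.diag_re j
    rw [hac j hj, Complex.zero_re] at h1
    exact (Finset.sum_eq_zero_iff_of_nonneg
      (fun a _ => mul_nonneg (Complex.normSq_nonneg _) (hl a))).1 h1.symm a (Finset.mem_univ a)
  have hk := fun a j => integral_kernel_term (hl a) (hy j) (hterm a j)
  have htr : X.trace.re = ∑ a, ∑ j, Complex.normSq (U j a) * l a := by
    rw [trace, Complex.re_sum, Finset.sum_comm]
    exact Finset.sum_congr rfl fun j _ => hU.diag_re j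
  refine ⟨fun t => ∑ a, ∑ j, Complex.normSq (U j a) *
    (l a * (l a - y j) / ((1 - t) * l a + t * y j)), ?_, ?_, ?_⟩
  · exact intervalIntegrable_finsetSum fun a => intervalIntegrable_finsetSum fun j => (hk a j).1
  · rw [intervalIntegral.integral_finsetSum]
    · have : ∀ a, ∫ t in (0 : ℝ)..1, ∑ j, Complex.normSq (U j a) *
          (l a * (l a - y j) / ((1 - t) * l a + t * y j)) =
          ∑ j, Complex.normSq (U j a) * (l a * (Real.log (l a) - Real.log (y j))) := by
        intro a
        rw [intervalIntegral.integral_finsetSum fun j _ => (hk a j).1]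
        exact Finset.sum_congr rfl fun j _ => (hk a j).2
      simp only [this]
      rw [relDiag, hU.negEntropy_eq]
      simp only [hU.diag_re, mul_sub, Finset.sum_sub_distrib, Finset.sum_mul]
      congr 1
      · refine Finset.sum_congr rfl fun a _ => ?_
        rw [← Finset.sum_mul, hU.sum_normSq_col, one_mul]
      · rw [Finset.sum_comm]
        simp only [mul_assoc]
    · intro a _
      exact intervalIntegrable_finsetSum fun j => (hk a j).1
  · intro t ht ht1
    refine ⟨fun Z => ?_, ?_⟩
    · rw [hU.varForm_eq, htr]
      simp only [Finset.mul_sum, ← Finset.sum_add_distrib]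
      exact Finset.sum_le_sum fun a _ => Finset.sum_le_sum fun j _ =>
        varForm_term_le ht ht1 (hl a) (hy j) _ _
    -- The entrywise maximiser $w=(l/c)u$ is prescribed for $ZU$, so $Z=WU^*$.
    · let W : Matrix A A ℂ := of fun j a =>
        ((l a / ((1 - t) * l a + t * y j) : ℝ) : ℂ) * U j a
      refine ⟨W * Uᴴ, ?_⟩
      rw [hU.varForm_eq, htr, mul_assoc, hU.star_mul, mul_one]
      simp only [Finset.mul_sum, ← Finset.sum_add_distrib]
      exact Finset.sum_congr rfl fun a _ => Finset.sum_congr rfl fun j _ =>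
        varForm_term_eq ht ht1 (hl a) (hy j) _

/-! ### Comparison principle and joint convexity -/

/-- Comparison principle: domination of the variational forms gives domination of the relative
entropies. -/
theorem relDiag_le_sum {A B ι : Type*} [Fintype A] [DecidableEq A] [Fintype B] [DecidableEq B]
    [Fintype ι] {X : Matrix A A ℂ} (hX : X.PosSemidef) {y : A → ℝ} (hy : ∀ j, 0 ≤ y j)
    (hac : ∀ j, y j = 0 → X j j = 0) {X' : ι → Matrix B B ℂ} (hX' : ∀ i, (X' i).PosSemidef)
    {y' : ι → B → ℝ} (hy' : ∀ i j, 0 ≤ y' i j) (hac' : ∀ i j, y' i j = 0 → X' i j j = 0)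
    {m : ι → ℝ} (hm : ∀ i, 0 ≤ m i) (htr : X.trace.re = ∑ i, m i * (X' i).trace.re)
    (h : ∀ t, 0 < t → t < 1 → ∀ Z, ∃ Z' : ι → Matrix B B ℂ,
      varForm t Z X (diagonal fun a => (y a : ℂ)) ≤
        ∑ i, m i * varForm t (Z' i) (X' i) (diagonal fun a => (y' i a : ℂ))) :
    relDiag X y ≤ ∑ i, m i * relDiag (X' i) (y' i) := by
  obtain ⟨g, hg1, hg2, hg3⟩ := exists_kernel hX hy hac
  choose k hk1 hk2 hk3 using fun i => exists_kernel (hX' i) (hy' i) (hac' i)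
  have hs : ∑ i, m i * relDiag (X' i) (y' i) = ∫ t in (0 : ℝ)..1, ∑ i, m i * k i t := by
    rw [intervalIntegral.integral_finsetSum fun i _ => (hk1 i).const_mul (m i)]
    refine Finset.sum_congr rfl fun i _ => ?_
    rw [intervalIntegral.integral_const_mul, hk2]
  rw [hs, ← hg2]
  refine intervalIntegral.integral_mono_on_of_le_Ioo zero_le_one hg1 ?_ fun t ht => ?_
  · exact intervalIntegrable_finsetSum fun i => (hk1 i).const_mul (m i)
  · obtain ⟨Z, hZ⟩ := (hg3 t ht.1 ht.2).2
    obtain ⟨Z', hZ'⟩ := h t ht.1 ht.2 Z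
    have h1 : ∑ i, m i * varForm t (Z' i) (X' i) (diagonal fun a => (y' i a : ℂ)) ≤
        ∑ i, m i * ((X' i).trace.re + t * k i t) :=
      Finset.sum_le_sum fun i _ =>
        mul_le_mul_of_nonneg_left ((hk3 i t ht.1 ht.2).1 (Z' i)) (hm i)
    have h2 : ∑ i, m i * ((X' i).trace.re + t * k i t) =
        X.trace.re + t * ∑ i, m i * k i t := by
      rw [htr, Finset.mul_sum, ← Finset.sum_add_distrib]
      exact Finset.sum_congr rfl fun i _ => by ring
    -- The trace terms cancel by `htr`, leaving the kernels multiplied by $t>0$.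
    have : t * g t ≤ t * ∑ i, m i * k i t := by linarith
    exact le_of_mul_le_mul_left this ht.1

theorem varForm_sum {A ι : Type*} [Fintype A] [Fintype ι] (t : ℝ) (Z : Matrix A A ℂ)
    (m : ι → ℝ) (X Y : ι → Matrix A A ℂ) :
    varForm t Z (∑ i, (m i : ℂ) • X i) (∑ i, (m i : ℂ) • Y i) =
      ∑ i, m i * varForm t Z (X i) (Y i) := by
  simp only [varForm, Finset.sum_mul, trace_sum, Complex.re_sum, smul_mul_assoc, trace_smul,
    smul_eq_mul, Complex.re_ofReal_mul, Finset.mul_sum, ← Finset.sum_sub_distrib]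
  exact Finset.sum_congr rfl fun i _ => by ring

theorem diagonal_sum_smul {A ι : Type*} [DecidableEq A] [Fintype ι] (m : ι → ℝ)
    (y : ι → A → ℝ) :
    diagonal (fun a => ((∑ i, m i * y i a : ℝ) : ℂ)) =
      ∑ i, (m i : ℂ) • diagonal fun a => (y i a : ℂ) := by
  ext a b
  rw [Matrix.sum_apply, diagonal_apply]
  split_ifs with h
  · subst h; simp
  · simp [h]

theorem posSemidef_sum_smul {A ι : Type*} [Fintype ι] {m : ι → ℝ} (hm : ∀ i, 0 ≤ m i)
    {X : ι → Matrix A A ℂ} (hX : ∀ i, (X i).PosSemidef) :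
    (∑ i, (m i : ℂ) • X i).PosSemidef :=
  posSemidef_sum _ fun i _ => (hX i).smul (by exact_mod_cast hm i)

theorem sum_smul_apply_eq_zero {A ι : Type*} [Fintype ι] {m : ι → ℝ} (hm : ∀ i, 0 ≤ m i)
    {X : ι → Matrix A A ℂ} {y : ι → A → ℝ} (hy : ∀ i j, 0 ≤ y i j)
    (hac : ∀ i j, y i j = 0 → X i j j = 0) (j : A) (h : ∑ i, m i * y i j = 0) :
    (∑ i, (m i : ℂ) • X i) j j = 0 := by
  rw [Matrix.sum_apply]
  refine Finset.sum_eq_zero fun i hi => ?_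
  have := (Finset.sum_eq_zero_iff_of_nonneg fun i _ => mul_nonneg (hm i) (hy i j)).1 h i hi
  rcases mul_eq_zero.1 this with h1 | h1
  · simp [h1]
  · simp [hac i j h1]

/-- Joint convexity of the relative entropy in `(X, diag y)`. -/
theorem relDiag_sum_le {A ι : Type*} [Fintype A] [DecidableEq A] [Fintype ι]
    {X : ι → Matrix A A ℂ} (hX : ∀ i, (X i).PosSemidef) {y : ι → A → ℝ}
    (hy : ∀ i j, 0 ≤ y i j) (hac : ∀ i j, y i j = 0 → X i j j = 0)
    {m : ι → ℝ} (hm : ∀ i, 0 ≤ m i) :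
    relDiag (∑ i, (m i : ℂ) • X i) (fun j => ∑ i, m i * y i j) ≤
      ∑ i, m i * relDiag (X i) (y i) := by
  refine relDiag_le_sum (posSemidef_sum_smul hm hX)
    (fun j => Finset.sum_nonneg fun i _ => mul_nonneg (hm i) (hy i j))
    (sum_smul_apply_eq_zero hm hy hac) hX hy hac hm ?_ fun t _ _ Z => ⟨fun _ => Z, ?_⟩
  · simp [trace_sum, trace_smul]
  · rw [diagonal_sum_smul, varForm_sum]

theorem trace_mul_nonneg {A : Type*} [Fintype A] [DecidableEq A] {X Y : Matrix A A ℂ}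
    (hX : X.PosSemidef) (hY : Y.PosSemidef) : 0 ≤ (X * Y).trace := by
  obtain ⟨U, l, hU, hl⟩ := exists_isDiagonalization hX
  have : (X * Y).trace = (diagonal (fun a => (l a : ℂ)) * (Uᴴ * Y * U)).trace := by
    conv_lhs => rw [hU.eq]
    rw [mul_assoc, mul_assoc, trace_mul_comm]
    simp only [mul_assoc]
  rw [this, trace]
  refine Finset.sum_nonneg fun a _ => ?_
  rw [diag_apply, diagonal_mul]
  exact mul_nonneg (by exact_mod_cast hl a) (hY.conjTranspose_mul_mul_same U).diag_nonneg

/-! ### Gibbs and Jensen inequalities; relative entropy to the dephased operator -/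

/-- Gibbs' inequality in one column. -/
theorem sum_mul_log_le {ι : Type*} [Fintype ι] {e f : ι → ℝ} (he : ∀ i, 0 ≤ e i)
    (hf : ∀ i, 0 ≤ f i) (hac : ∀ i, f i = 0 → e i = 0) (hs : ∑ i, f i = ∑ i, e i) :
    ∑ i, e i * Real.log (f i) ≤ ∑ i, e i * Real.log (e i) := by
  have : ∀ i, e i * Real.log (f i) - e i * Real.log (e i) ≤ f i - e i := by
    intro i
    rcases eq_or_lt_of_le (he i) with h | h
    · rw [← h]; simpa using hf i
    · have hfi : 0 < f i := lt_of_le_of_ne (hf i) fun h0 => h.ne' (hac i h0.symm)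
      have := Real.log_le_sub_one_of_pos (div_pos hfi h)
      rw [Real.log_div hfi.ne' h.ne'] at this
      have := mul_le_mul_of_nonneg_left this h.le
      rw [mul_sub, mul_sub, mul_div_cancel₀ _ h.ne'] at this
      linarith
  have := Finset.sum_le_sum fun i (_ : i ∈ Finset.univ) => this i
  rw [Finset.sum_sub_distrib, Finset.sum_sub_distrib] at this
  linarith

theorem IsDiagonalization.relDiag_diag_eq {A : Type*} [Fintype A] [DecidableEq A]
    {X U : Matrix A A ℂ} {l : A → ℝ} (h : IsDiagonalization X U l) :
    relDiag X (fun j => (X j j).re) = ∑ j, (∑ a, Complex.normSq (U j a) * (l a * Real.log (l a)) -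
      (X j j).re * Real.log (X j j).re) := by
  rw [relDiag, h.negEntropy_eq, Finset.sum_sub_distrib, Finset.sum_comm]
  congr 1
  refine Finset.sum_congr rfl fun a _ => ?_
  rw [← Finset.sum_mul, h.sum_normSq_col, one_mul]

/-- Jensen's inequality for $x\log x$: $X_{jj}$ is the average of the eigenvalues with weights
$|U_{ja}|^2$, which sum to one over $a$. -/
theorem IsDiagonalization.diag_mul_log_le {A : Type*} [Fintype A] [DecidableEq A]
    {X U : Matrix A A ℂ} {l : A → ℝ} (h : IsDiagonalization X U l) (hl : ∀ a, 0 ≤ l a) (j : A) :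
    (X j j).re * Real.log (X j j).re ≤
      ∑ a, Complex.normSq (U j a) * (l a * Real.log (l a)) := by
  have := Real.strictConvexOn_mul_log.convexOn.map_sum_le (t := Finset.univ)
    (w := fun a => Complex.normSq (U j a)) (p := l) (fun a _ => Complex.normSq_nonneg _)
    (h.sum_normSq_row j) (fun a _ => hl a)
  simpa only [smul_eq_mul, ← h.diag_re j] using this

/-- The relative entropy to the dephased operator is non-negative. -/
theorem relDiag_diag_nonneg {A : Type*} [Fintype A] [DecidableEq A] {X : Matrix A A ℂ}
    (hX : X.PosSemidef) : 0 ≤ relDiag X (fun j => (X j j).re) := by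
  obtain ⟨U, l, hU, hl⟩ := exists_isDiagonalization hX
  rw [hU.relDiag_diag_eq]
  exact Finset.sum_nonneg fun j _ => sub_nonneg.2 (hU.diag_mul_log_le hl j)

/-- The relative entropy to the dephased operator vanishes only on diagonal operators. -/
theorem isDiag_of_relDiag_diag_eq_zero {A : Type*} [Fintype A] [DecidableEq A]
    {X : Matrix A A ℂ} (hX : X.PosSemidef) (h0 : relDiag X (fun j => (X j j).re) = 0) :
    X.IsDiag := by
  obtain ⟨U, l, hU, hl⟩ := exists_isDiagonalization hX
  rw [hU.relDiag_diag_eq] at h0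
  have h1 := (Finset.sum_eq_zero_iff_of_nonneg fun j _ =>
    sub_nonneg.2 (hU.diag_mul_log_le hl j)).1 h0
  intro i j hij
  have h2 := sub_eq_zero.1 (h1 j (Finset.mem_univ j))
  -- Equality in strict Jensen: every eigenvalue whose eigenvector meets $e_j$ equals $X_{jj}$.
  -- Hence $X_{ij}=X_{jj}(UU^*)_{ij}$, which vanishes off the diagonal.
  have h3 := (Real.strictConvexOn_mul_log.map_sum_eq_iff' (t := Finset.univ)
    (w := fun a => Complex.normSq (U j a)) (p := l) (fun a _ => Complex.normSq_nonneg _)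
    (hU.sum_normSq_row j) (fun a _ => hl a)).1
      (by simpa only [smul_eq_mul, ← hU.diag_re j] using h2.symm)
  simp only [smul_eq_mul, ← hU.diag_re j] at h3
  have h4 : X i j = ∑ a, ((X j j).re : ℂ) * (U i a * star (U j a)) := by
    rw [hU.apply_eq]
    refine Finset.sum_congr rfl fun a _ => ?_
    by_cases hu : U j a = 0
    · simp [hu]
    · rw [h3 a (Finset.mem_univ a) (by simpa [Complex.normSq_eq_zero] using hu)]
      ring
  rw [h4, ← Finset.mul_sum]
  have h5 := congrFun (congrFun hU.mul_star i) j
  rw [mul_apply, one_apply_ne hij] at h5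
  simp only [conjTranspose_apply] at h5
  rw [h5, mul_zero]

theorem relDiag_diag_eq_zero_of_isDiag {A : Type*} [Fintype A] [DecidableEq A]
    {X : Matrix A A ℂ} (hX : X.PosSemidef) (h : X.IsDiag) :
    relDiag X (fun j => (X j j).re) = 0 := by
  have h1 : X = diagonal fun j => ((X j j).re : ℂ) := by
    ext i j
    rw [diagonal_apply]
    split_ifs with hij
    · subst hij
      exact (Complex.conj_eq_iff_re.1 (hX.1.apply i i)).symm
    · exact h hij
  have hU : IsDiagonalization X 1 fun j => (X j j).re := ⟨by simp, by simp, by simpa using h1⟩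
  rw [relDiag, hU.negEntropy_eq, sub_self]

/-! ### Completely positive maps, adjoints and the Schwarz inequality -/

theorem dephase_apply {A : Type*} [DecidableEq A] (X : Matrix A A ℂ) :
    dephase A X = diagonal X.diag := rfl

theorem ampliate_apply {A B : Type*} (R : Type*) (E : SuperOp A B)
    (X : Matrix (A × R) (A × R) ℂ) (p q : B × R) :
    ampliate R E X p q = E (of fun i j => X (i, p.2) (j, q.2)) p.1 q.1 := rfl

theorem IsCompletelyPositive.map_posSemidef {A B : Type*} {E : SuperOp A B}
    (hE : IsCompletelyPositive E) {X : Matrix A A ℂ} (hX : X.PosSemidef) : (E X).PosSemidef := by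
  have h := hE 1 (X.submatrix Prod.fst Prod.fst) (hX.submatrix _)
  exact h.submatrix fun b : B => (b, (0 : Fin 1))

/-- Complete positivity applied to the Gram matrix of a pair of operators. -/
theorem IsCompletelyPositive.gram_posSemidef {A B : Type*} [Fintype A] {E : SuperOp A B}
    (hE : IsCompletelyPositive E) (V : Fin 2 → Matrix A A ℂ) :
    (of fun p q : B × Fin 2 => E ((V p.2)ᴴ * V q.2) p.1 q.1).PosSemidef := by
  have h := hE 2 _ (posSemidef_conjTranspose_mul_self
    (of fun (k : A) (p : A × Fin 2) => V p.2 k p.1))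
  exact h

theorem IsCompletelyPositive.comp {A B C : Type*} {F : SuperOp B C} {E : SuperOp A B}
    (hF : IsCompletelyPositive F) (hE : IsCompletelyPositive E) :
    IsCompletelyPositive (F ∘ₗ E) := fun k X hX => hF k _ (hE k X hX)

theorem IsChannel.comp {A B C : Type*} [Fintype A] [Fintype B] [Fintype C] {F : SuperOp B C}
    {E : SuperOp A B} (hF : IsChannel F) (hE : IsChannel E) : IsChannel (F ∘ₗ E) :=
  ⟨hF.1.comp hE.1, fun X => (hF.2 _).trans (hE.2 X)⟩

theorem IsChannel.convex {A B : Type*} [Fintype A] [Fintype B] {E G : SuperOp A B}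
    (hE : IsChannel E) (hG : IsChannel G) {p : ℝ} (h0 : 0 ≤ p) (h1 : p ≤ 1) :
    IsChannel ((p : ℂ) • E + ((1 - p : ℝ) : ℂ) • G) := by
  refine ⟨fun k X hX => ?_, fun X => ?_⟩
  · exact ((hE.1 k X hX).smul (a := (p : ℂ)) (by exact_mod_cast h0)).add
      ((hG.1 k X hX).smul (a := ((1 - p : ℝ) : ℂ)) (by exact_mod_cast sub_nonneg.2 h1))
  · rw [LinearMap.add_apply, LinearMap.smul_apply, LinearMap.smul_apply, trace_add, trace_smul,
      trace_smul, hE.2, hG.2, ← add_smul]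
    simp

/-- The off-diagonal blocks of the Gram matrix of $(Z,1)$ are $E(Z^*)$ and $E(Z)$, and a positive
semidefinite matrix is Hermitian. -/
theorem IsCompletelyPositive.map_conjTranspose {A B : Type*} [Fintype A]
    [DecidableEq A] {E : SuperOp A B} (hE : IsCompletelyPositive E) (Z : Matrix A A ℂ) :
    E Zᴴ = (E Z)ᴴ := by
  have h := (hE.gram_posSemidef ![Z, 1]).1
  ext i j
  have := h.apply (i, 0) (j, 1)
  simpa using this.symm

theorem dual_ext {A B : Type*} [Fintype A] [DecidableEq A] [Fintype B] {E : SuperOp A B}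
    {X : Matrix B B ℂ} {Y : Matrix A A ℂ}
    (h : ∀ ρ, (Y * ρ).trace = (X * E ρ).trace) : dual E X = Y :=
  ext_iff_trace_mul_right.2 fun ρ => by rw [trace_dual_mul, h]

theorem dual_comp {A B C : Type*} [Fintype A] [DecidableEq A] [Fintype B] [DecidableEq B]
    [Fintype C] (F : SuperOp B C) (E : SuperOp A B)
    (X : Matrix C C ℂ) : dual (F ∘ₗ E) X = dual E (dual F X) :=
  dual_ext fun ρ => by rw [trace_dual_mul, trace_dual_mul]; rfl

section Positivity

variable {A B : Type*} [Fintype A] [DecidableEq A] [Fintype B] [DecidableEq B]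

/-- The Kadison–Schwarz inequality for unital completely positive maps. -/
theorem IsCompletelyPositive.schwarz {L : SuperOp A B} (hL : IsCompletelyPositive L)
    (hu : IsUnital L) (Z : Matrix A A ℂ) : (L (Zᴴ * Z) - (L Z)ᴴ * L Z).PosSemidef := by
  have h := hL.gram_posSemidef ![Z, 1]
  -- The blocks are $L(Z^*Z)$, $L(Z)^*$, $L(Z)$, $L(1)=1$. Compressing by the column $(1,-L(Z))$
  -- leaves the Schur complement of the unit block.
  have h2 := h.conjTranspose_mul_mul_same
    (of fun (p : B × Fin 2) (b : B) => ![(1 : Matrix B B ℂ), -L Z] p.2 p.1 b)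
  convert h2 using 1
  have hu' : L 1 = 1 := hu
  ext i j
  simp only [mul_apply, Fintype.sum_prod_type, Fin.sum_univ_two, conjTranspose_apply, of_apply]
  simp only [cons_val_zero, cons_val_one, mul_one, conjTranspose_one, one_mul, hu',
    hL.map_conjTranspose]
  simp [one_apply, mul_apply, Finset.sum_add_distrib, sub_eq_add_neg]

theorem IsCompletelyPositive.dual_posSemidef {E : SuperOp A B} (hE : IsCompletelyPositive E)
    {X : Matrix B B ℂ} (hX : X.PosSemidef) : (dual E X).PosSemidef := by
  refine PosSemidef.of_dotProduct_mulVec_nonneg ?_ fun v => ?_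
  · ext i j
    change star ((X * E (single i j 1)).trace) = (X * E (single j i 1)).trace
    rw [← trace_conjTranspose, conjTranspose_mul, ← hE.map_conjTranspose, hX.1.eq,
      trace_mul_comm, conjTranspose_single, star_one]
  · have : star v ⬝ᵥ (dual E X) *ᵥ v = (dual E X * vecMulVec v (star v)).trace := by
      rw [mul_vecMulVec, trace_vecMulVec, dotProduct_comm]
    rw [this, trace_dual_mul]
    exact trace_mul_nonneg hX (hE.map_posSemidef (posSemidef_vecMulVec_self_star v))

theorem isChannel_dephase : IsChannel (dephase A) := by
  refine ⟨fun k X hX => ?_, fun X => by simp [dephase_apply, trace]⟩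
  -- Kraus form of dephasing: pinching by the projectors $|a\rangle\langle a|\otimes 1$.
  have : ampliate (Fin k) (dephase A) X = ∑ a : A,
      (diagonal fun p : A × Fin k => if p.1 = a then (1 : ℂ) else 0)ᴴ * X *
        diagonal fun p : A × Fin k => if p.1 = a then (1 : ℂ) else 0 := by
    ext ⟨i, r⟩ ⟨j, s⟩
    rw [Matrix.sum_apply]
    simp only [diagonal_conjTranspose, mul_diagonal, diagonal_mul]
    by_cases hij : i = j
    · subst hij
      simp [ampliate_apply, dephase_apply]
    · simp [ampliate_apply, dephase_apply, hij]
  rw [this]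
  exact posSemidef_sum _ fun a _ => hX.conjTranspose_mul_mul_same _

theorem trace_dual {E : SuperOp A B} (hu : IsUnital E) (X : Matrix B B ℂ) :
    (dual E X).trace = X.trace := by
  have := trace_dual_mul E X 1
  rwa [mul_one, show E 1 = 1 from hu, mul_one] at this

end Positivity

/-! ### Basis effects, detection-incoherence and data processing -/

/-- The effect `E†(|i⟩⟨i|)` of the channel followed by the incoherent basis measurement. -/
def effect {A B : Type*} [DecidableEq A] [Fintype B] [DecidableEq B] (E : SuperOp A B) (i : B) :
    Matrix A A ℂ :=
  dual E (single i i 1)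

/-- The transition probabilities `⟨i|E(|j⟩⟨j|)|i⟩`. -/
def transition {A B : Type*} [DecidableEq A] (E : SuperOp A B) (i : B) (j : A) : ℝ :=
  (E (single j j 1) i i).re

/-- The channel `Δ ∘ E ∘ Δ`. -/
def dephased {A : Type*} [DecidableEq A] (E : SuperOp A A) : SuperOp A A :=
  dephase A ∘ₗ E ∘ₗ dephase A

theorem dephase_dephase {A : Type*} [DecidableEq A] : dephase A ∘ₗ dephase A = dephase A := by
  ext X : 1
  simp [dephase_apply]

theorem transition_dephased {A : Type*} [DecidableEq A] (E : SuperOp A A) (i j : A) :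
    transition (dephased E) i j = transition E i j := by
  simp only [transition, dephased, LinearMap.comp_apply]
  have : dephase A (single j j (1 : ℂ)) = single j j 1 := by
    simp [dephase_apply, diagonal_single]
  rw [this]
  simp [dephase_apply]

section Effects

variable {A : Type*} [Fintype A] [DecidableEq A]

theorem effect_apply (E : SuperOp A A) (i j k : A) : effect E i j k = E (single k j 1) i i := by
  change (single i i 1 * E (single k j 1)).trace = _
  simp [trace_single_mul]

theorem posSemidef_single_self {B : Type*} [Fintype B] [DecidableEq B] (i : B) :
    (single i i (1 : ℂ)).PosSemidef := by
  rw [← diagonal_single]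
  exact PosSemidef.diagonal (Pi.single_nonneg.2 zero_le_one)

theorem diagonal_eq_sum_single {B : Type*} [Fintype B] [DecidableEq B] (d : B → ℂ) :
    diagonal d = ∑ p, d p • single p p (1 : ℂ) := by
  rw [← sum_single_eq_diagonal]
  simp

theorem IsChannel.effect_posSemidef {E : SuperOp A A} (hE : IsChannel E) (i : A) :
    (effect E i).PosSemidef :=
  hE.1.dual_posSemidef (posSemidef_single_self i)

theorem IsChannel.effect_diag {E : SuperOp A A} (hE : IsChannel E) (i j : A) :
    effect E i j j = (transition E i j : ℂ) := by
  rw [transition, ← effect_apply]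
  exact (Complex.conj_eq_iff_re.1 ((hE.effect_posSemidef i).1.apply j j)).symm

theorem IsChannel.transition_nonneg {E : SuperOp A A} (hE : IsChannel E) (i j : A) :
    0 ≤ transition E i j := by
  have := (hE.effect_posSemidef i).diag_nonneg (i := j)
  rw [hE.effect_diag] at this
  exact_mod_cast this

theorem IsChannel.sum_transition {E : SuperOp A A} (hE : IsChannel E) (j : A) :
    ∑ i, transition E i j = 1 := by
  have h := hE.2 (single j j 1)
  rw [trace_single_eq_same, trace] at h
  have := congrArg Complex.re h
  rwa [Complex.re_sum, Complex.one_re] at this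

/-- The entry $E(X)_{ii}$ is $\operatorname{tr}(E_iX)$, which depends on the diagonal of $X$ alone
exactly when $E_i$ is diagonal. -/
theorem isDIO_iff_isDiag_effect {E : SuperOp A A} (hE : IsChannel E) :
    IsDIO E ↔ ∀ i, (effect E i).IsDiag := by
  constructor
  · intro h i j k hjk
    rw [effect_apply]
    have := congrFun (congrFun (LinearMap.congr_fun h.2 (single k j 1)) i) i
    simp only [LinearMap.comp_apply, dephase_apply,
      diagonal_apply_eq, diag_apply] at this
    rw [this]
    have hz : diagonal (single k j (1 : ℂ)).diag = 0 := by
      ext a b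
      rw [diagonal_apply, diag_apply, single_apply]
      rw [Matrix.zero_apply]
      split_ifs with h1 h2
      · exact absurd (h2.2.trans h2.1.symm) hjk
      · rfl
      · rfl
    rw [hz, map_zero]; rfl
  · intro h
    refine ⟨hE, LinearMap.ext fun X => ?_⟩
    have key : ∀ i, E X i i = E (diagonal X.diag) i i := by
      intro i
      have h1 : ∀ Y : Matrix A A ℂ, E Y i i = (effect E i * Y).trace := by
        intro Y
        rw [effect, trace_dual_mul, trace_single_mul]
        simp
      rw [h1, h1, trace, trace]
      refine Finset.sum_congr rfl fun j _ => ?_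
      rw [diag_apply, diag_apply, mul_apply, mul_diagonal, Finset.sum_eq_single j]
      · rfl
      · intro k _ hk
        rw [h i (Ne.symm hk), zero_mul]
      · simp
    ext i j
    simp only [LinearMap.comp_apply, dephase_apply, diagonal_apply]
    split_ifs
    · exact key i
    · rfl

theorem IsDIO.effect_eq {F : SuperOp A A} (hF : IsDIO F) (i : A) :
    effect F i = diagonal fun j => (transition F i j : ℂ) := by
  ext j k
  rw [diagonal_apply]
  split_ifs with h
  · subst h
    exact hF.1.effect_diag i j
  · exact (isDIO_iff_isDiag_effect hF.1).1 hF i h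

theorem IsDIO.dual_diagonal {F : SuperOp A A} (hF : IsDIO F) (y : A → ℝ) :
    dual F (diagonal fun b => (y b : ℂ)) =
      diagonal fun a => ((∑ b, y b * transition F b a : ℝ) : ℂ) := by
  rw [diagonal_eq_sum_single, map_sum, diagonal_sum_smul]
  refine Finset.sum_congr rfl fun b _ => ?_
  rw [map_smul, ← hF.effect_eq]; rfl

theorem isDIO_dephased {E : SuperOp A A} (hE : IsChannel E) : IsDIO (dephased E) := by
  refine ⟨isChannel_dephase.comp (hE.comp isChannel_dephase), ?_⟩
  simp only [dephased, LinearMap.comp_assoc, dephase_dephase]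

/-- Data processing under the dual of a unital detection-incoherent operation. -/
theorem relDiag_dual_le {L : SuperOp A A} (hL : IsDIO L) (hu : IsUnital L) {X : Matrix A A ℂ}
    (hX : X.PosSemidef) {y : A → ℝ} (hy : ∀ j, 0 ≤ y j) (hac : ∀ j, y j = 0 → X j j = 0) :
    (∀ a, ∑ b, y b * transition L b a = 0 → (dual L X) a a = 0) ∧
    relDiag (dual L X) (fun a => ∑ b, y b * transition L b a) ≤ relDiag X y := by
  have hac' : ∀ a, ∑ b, y b * transition L b a = 0 → (dual L X) a a = 0 := by
    intro a ha
    have h0 := (Finset.sum_eq_zero_iff_of_nonneg fun b _ =>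
      mul_nonneg (hy b) (hL.1.transition_nonneg b a)).1 ha
    have hP := hL.1.1.map_posSemidef (posSemidef_single_self a)
    change (X * L (single a a 1)).trace = 0
    rw [trace_mul_comm, trace]
    refine Finset.sum_eq_zero fun c _ => ?_
    rw [diag_apply, mul_apply]
    refine Finset.sum_eq_zero fun b _ => ?_
    -- Each index $b$ is killed either by $X$, through $y_b=0$, or by $L(|a\rangle\langle a|)$,
    -- through a vanishing transition probability.
    rcases mul_eq_zero.1 (h0 b (Finset.mem_univ b)) with h | h
    · have := posSemidef_col_eq_zero hX (hac b h) c
      rw [← hX.1.apply, this]; simp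
    · have h1 : L (single a a 1) b b = 0 := by
        rw [← effect_apply, hL.1.effect_diag, h, Complex.ofReal_zero]
      rw [posSemidef_col_eq_zero hP h1 c, zero_mul]
  refine ⟨hac', ?_⟩
  have := relDiag_le_sum (ι := Unit) (hL.1.1.dual_posSemidef hX)
    (fun a => Finset.sum_nonneg fun b _ => mul_nonneg (hy b) (hL.1.transition_nonneg b a))
    hac' (X' := fun _ => X) (fun _ => hX) (y' := fun _ => y) (fun _ => hy) (fun _ => hac)
    (m := fun _ => 1) (fun _ => zero_le_one) (by simp [trace_dual hu])
    (fun t ht ht1 Z => ⟨fun _ => L Z, ?_⟩)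
  · simpa using this
  · rw [← hL.dual_diagonal]
    simp only [varForm, trace_dual_mul, Fintype.sum_unique, one_mul]
    -- Passing from $Z$ to $L(Z)$ keeps the linear term and can only shrink the two subtracted
    -- quadratic terms: Schwarz for $Z$ against $X$ and for $Z^*$ against $\operatorname{diag}(y)$.
    have h1 := Complex.nonneg_iff.1 (trace_mul_nonneg hX (hL.1.1.schwarz hu Z))
    have hY : (diagonal fun a => (y a : ℂ)).PosSemidef :=
      posSemidef_diagonal_iff.2 fun a => by exact_mod_cast hy a
    have h2 := Complex.nonneg_iff.1 (trace_mul_nonneg hY (hL.1.1.schwarz hu Zᴴ))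
    rw [hL.1.1.map_conjTranspose, conjTranspose_conjTranspose, conjTranspose_conjTranspose] at h2
    rw [mul_sub, trace_sub, Complex.sub_re] at h1 h2
    have h3 := mul_nonneg (sub_pos.2 ht1).le h1.1
    have h4 := mul_nonneg ht.le h2.1
    linarith

end Effects

/-! ### Finite sums of extended reals -/

section EReal

theorem ereal_sum_ne_bot {ι : Type*} {s : Finset ι} {f : ι → EReal} (h : ∀ i ∈ s, f i ≠ ⊥) :
    ∑ i ∈ s, f i ≠ ⊥ :=
  Finset.sum_induction f (· ≠ ⊥) (fun _ _ ha hb => EReal.add_ne_bot_iff.2 ⟨ha, hb⟩)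
    EReal.zero_ne_bot h

theorem ereal_sum_eq_top {ι : Type*} [Fintype ι] {f : ι → EReal} (h : ∀ i, f i ≠ ⊥) {i : ι}
    (hi : f i = ⊤) : ∑ i, f i = ⊤ := by
  classical
  rw [← Finset.add_sum_erase _ _ (Finset.mem_univ i), hi,
    EReal.top_add_of_ne_bot (ereal_sum_ne_bot fun j _ => h j)]

theorem ereal_coe_sum {ι : Type*} (s : Finset ι) (f : ι → ℝ) :
    ∑ i ∈ s, (f i : EReal) = ((∑ i ∈ s, f i : ℝ) : EReal) :=
  (map_sum (⟨⟨Real.toEReal, EReal.coe_zero⟩, EReal.coe_add⟩ : ℝ →+ EReal) f s).symm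

end EReal

/-! ### Optimality of the incoherent basis measurement -/

theorem kronecker_diagonal_single {A R : Type*} [DecidableEq A] [Fintype R] [DecidableEq R]
    (y : A → ℝ) (r : R) :
    kroneckerMap (· * ·) (diagonal fun a => (y a : ℂ)) (single r r 1) =
      diagonal fun p : A × R => ((if p.2 = r then y p.1 else 0 : ℝ) : ℂ) := by
  rw [← diagonal_single, diagonal_kronecker_diagonal]
  congr 1
  ext p
  by_cases h : p.2 = r <;> simp [h]

theorem kronecker_single_apply_self {A R : Type*} [DecidableEq R] {X : Matrix A A ℂ}
    {y : A → ℝ} (hac : ∀ j, y j = 0 → X j j = 0) (r : R) (p : A × R)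
    (h : (if p.2 = r then y p.1 else 0) = 0) :
    kroneckerMap (· * ·) X (single r r 1) p p = 0 := by
  rw [kroneckerMap_apply]
  split_ifs at h with h1
  · rw [hac _ h, zero_mul]
  · simp [Ne.symm h1]

variable {A : Type*} [Fintype A] [DecidableEq A]

theorem relEntropy_ne_bot (X Y : Matrix A A ℂ) : relEntropy X Y ≠ ⊥ := by
  rw [relEntropy]
  split_ifs
  · exact EReal.coe_ne_bot _
  · exact top_ne_bot

/-- The effects of `E ⊗ id` for the product incoherent basis. -/
theorem effect_ampliate {R : Type*} [Fintype R] [DecidableEq R] (E : SuperOp A A) (p : A × R) :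
    dual (ampliate R E) (single p p 1) =
      kroneckerMap (· * ·) (effect E p.1) (single p.2 p.2 1) := by
  rcases p with ⟨i, r⟩
  ext ⟨j, s⟩ ⟨k, t⟩
  change (single (i, r) (i, r) 1 * ampliate R E (single (k, t) (j, s) 1)).trace = _
  rw [trace_single_mul, kroneckerMap_apply, effect_apply, ampliate_apply]
  by_cases h : r = s ∧ r = t
  · obtain ⟨rfl, rfl⟩ := h
    have : (of fun a b => single (k, r) (j, r) (1 : ℂ) (a, r) (b, r)) = single k j 1 := by
      ext a b; simp [single_apply]
    simp [this]
  · have : (of fun a b => single (k, t) (j, s) (1 : ℂ) (a, r) (b, r)) = 0 := by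
      ext a b
      rw [of_apply, single_apply, if_neg]
      · rfl
      · rintro ⟨h1, h2⟩
        exact h ⟨(Prod.ext_iff.1 h2).2.symm, (Prod.ext_iff.1 h1).2.symm⟩
    rw [this, map_zero, single_apply, if_neg h]
    simp

theorem relEntropy_kronecker {R : Type*} [Fintype R] [DecidableEq R] {X : Matrix A A ℂ}
    (hX : X.PosSemidef) (y : A → ℝ) (r : R) :
    relEntropy (kroneckerMap (· * ·) X (single r r 1))
        (kroneckerMap (· * ·) (diagonal fun a => (y a : ℂ)) (single r r 1)) =
      relEntropy X (diagonal fun a => (y a : ℂ)) := by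
  rw [kronecker_diagonal_single, relEntropy_diagonal (hX.kronecker (posSemidef_single_self r)),
    relEntropy_diagonal hX, relDiag_kronecker hX]
  congr 1
  refine propext ⟨fun h j hj => ?_, fun h p hp => kronecker_single_apply_self h r p hp⟩
  simpa using h (j, r) (by simpa using hj)

/-- The divergence `(1/d) ∑ i, D(E†(|i⟩⟨i|)‖F†(|i⟩⟨i|))`. -/
def basisDivergence (E F : SuperOp A A) : EReal :=
  ((1 / (Fintype.card A : ℝ) : ℝ) : EReal) * ∑ i, relEntropy (effect E i) (effect F i)

/-- The support condition between the transition probabilities of two channels. -/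
def Dominates (F E : SuperOp A A) : Prop := ∀ i j, transition F i j = 0 → effect E i j j = 0

theorem basisDivergence_eq_coe {E F : SuperOp A A} (hE : IsChannel E) (hF : IsDIO F)
    (h : Dominates F E) :
    basisDivergence E F =
      ((1 / (Fintype.card A : ℝ) * ∑ i, relDiag (effect E i) (transition F i) : ℝ) : EReal) := by
  rw [basisDivergence, EReal.coe_mul, ← ereal_coe_sum]
  congr 1
  refine Finset.sum_congr rfl fun i _ => ?_
  rw [hF.effect_eq, relEntropy_diagonal (hE.effect_posSemidef i), if_pos (h i)]

theorem basisDivergence_eq_top [Nonempty A] {E F : SuperOp A A} (hE : IsChannel E) (hF : IsDIO F)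
    (h : ¬ Dominates F E) : basisDivergence E F = ⊤ := by
  obtain ⟨i, hi⟩ := not_forall.1 h
  rw [basisDivergence, ereal_sum_eq_top (fun i => relEntropy_ne_bot _ _) (i := i),
    EReal.coe_mul_top_of_pos (by positivity)]
  rw [hF.effect_eq, relEntropy_diagonal (hE.effect_posSemidef i), if_neg hi]

/-- This exhibits an incoherent measurement as the basis measurement followed by the classical
channel $m$. -/
theorem IsIncoherentMeasurement.exists_weights {n : ℕ} {M : Fin n → Matrix A A ℂ}
    (hM : IsIncoherentMeasurement M) : ∃ m : Fin n → A → ℝ, (∀ x p, 0 ≤ m x p) ∧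
      (∀ p, ∑ x, m x p = 1) ∧ ∀ x, M x = ∑ p, (m x p : ℂ) • single p p 1 := by
  have hre : ∀ x p, M x p p = ((M x p p).re : ℂ) := fun x p =>
    (Complex.conj_eq_iff_re.1 ((hM.1.1 x).1.apply p p)).symm
  refine ⟨fun x p => (M x p p).re, fun x p => ?_, fun p => ?_, fun x => ?_⟩
  · exact (Complex.nonneg_iff.1 (hM.1.1 x).diag_nonneg).1
  · have := congrFun (congrFun hM.1.2 p) p
    rw [Matrix.sum_apply, one_apply_eq] at this
    have := congrArg Complex.re this
    rwa [Complex.re_sum, Complex.one_re] at this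
  · rw [← diagonal_eq_sum_single, ← hM.2 x, dephase_apply]
    congr 1
    ext p
    exact hre x p

theorem dual_ampliate_sum {R : Type*} [Fintype R] [DecidableEq R] (E : SuperOp A A)
    (m : A × R → ℝ) :
    dual (ampliate R E) (∑ p, (m p : ℂ) • single p p 1) =
      ∑ p, (m p : ℂ) • kroneckerMap (· * ·) (effect E p.1) (single p.2 p.2 1) := by
  rw [map_sum]
  exact Finset.sum_congr rfl fun p _ => by rw [map_smul, effect_ampliate]

/-- The convexity inequality `relDiag_sum_le` holds for arbitrary non-negative weights, so the
weights of a single outcome need not sum to one. -/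
theorem relEntropy_dual_ampliate_le {R : Type*} [Fintype R] [DecidableEq R] {E F : SuperOp A A}
    (hE : IsChannel E) (hF : IsDIO F) (h : Dominates F E) {m : A × R → ℝ} (hm : ∀ p, 0 ≤ m p) :
    relEntropy (dual (ampliate R E) (∑ p, (m p : ℂ) • single p p 1))
        (dual (ampliate R F) (∑ p, (m p : ℂ) • single p p 1)) ≤
      ((∑ p, m p * relDiag (effect E p.1) (transition F p.1) : ℝ) : EReal) := by
  have hX : ∀ p : A × R, (kroneckerMap (· * ·) (effect E p.1) (single p.2 p.2 1)).PosSemidef :=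
    fun p => (hE.effect_posSemidef p.1).kronecker (posSemidef_single_self p.2)
  have hy : ∀ (p q : A × R), 0 ≤ if q.2 = p.2 then transition F p.1 q.1 else 0 := by
    intro p q
    split_ifs
    · exact hF.1.transition_nonneg _ _
    · exact le_rfl
  have hac := fun (p q : A × R) (hq : (if q.2 = p.2 then transition F p.1 q.1 else 0) = 0) =>
    kronecker_single_apply_self (h p.1) p.2 q hq
  rw [dual_ampliate_sum, dual_ampliate_sum]
  simp only [hF.effect_eq, kronecker_diagonal_single]
  rw [← diagonal_sum_smul, relEntropy_diagonal (posSemidef_sum_smul hm hX),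
    if_pos (sum_smul_apply_eq_zero hm hy hac)]
  refine EReal.coe_le_coe_iff.2 ((relDiag_sum_le hX hy hac hm).trans_eq ?_)
  exact Finset.sum_congr rfl fun p _ => by rw [relDiag_kronecker (hE.effect_posSemidef p.1)]

theorem measDivergence_le [Nonempty A] {R : Type*} [Fintype R] [DecidableEq R] [Nonempty R]
    {E F : SuperOp A A}
    (hE : IsChannel E) (hF : IsDIO F) {n : ℕ} {M : Fin n → Matrix (A × R) (A × R) ℂ}
    (hM : IsIncoherentMeasurement M) : measDivergence M E F ≤ basisDivergence E F := by
  by_cases h : Dominates F E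
  · obtain ⟨m, hm0, hm1, hm⟩ := hM.exists_weights
    -- Over all outcomes each basis pair $(i,r)$ has total weight one, and its term does not depend
    -- on $r$; this produces the factor $|R|$, cancelled by the dimension $d|R|$ in the
    -- normalisation.
    have h1 : ∑ x, relEntropy (preProcess M (ampliate R E) x) (preProcess M (ampliate R F) x) ≤
        (((Fintype.card R : ℝ) * ∑ i, relDiag (effect E i) (transition F i) : ℝ) : EReal) := by
      calc _ ≤ ∑ x, ((∑ p : A × R, m x p * relDiag (effect E p.1) (transition F p.1) : ℝ) :
              EReal) := Finset.sum_le_sum fun x _ => by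
            rw [preProcess, preProcess, hm x]
            exact relEntropy_dual_ampliate_le hE hF h (hm0 x)
        _ = _ := by
            rw [ereal_coe_sum, Finset.sum_comm]
            simp only [← Finset.sum_mul, hm1, one_mul]
            rw [Fintype.sum_prod_type, Finset.mul_sum]
            simp
    rw [basisDivergence_eq_coe hE hF h, measDivergence, measRelEntropy]
    refine (mul_le_mul_of_nonneg_left h1 (by positivity)).trans_eq ?_
    rw [← EReal.coe_mul, Fintype.card_prod]
    congr 1
    push_cast
    field_simp
  · rw [basisDivergence_eq_top hE hF h]
    exact le_top

theorem isIncoherentMeasurement_single {n : ℕ} (e : Fin n ≃ A) :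
    IsIncoherentMeasurement fun x => single (e x) (e x) (1 : ℂ) := by
  refine ⟨⟨fun x => posSemidef_single_self _, ?_⟩, fun x => ?_⟩
  · rw [e.sum_comp fun a => single a a (1 : ℂ), sum_single_eq_diagonal]
    exact diagonal_one
  · rw [dephase_apply, ← diagonal_single, diag_diagonal]

theorem measDivergence_single {R : Type*} [Fintype R] [DecidableEq R] [Unique R]
    {E F : SuperOp A A} (hE : IsChannel E) (hF : IsDIO F) {n : ℕ} (e : Fin n ≃ A × R) :
    measDivergence (fun x => single (e x) (e x) (1 : ℂ)) E F = basisDivergence E F := by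
  rw [measDivergence, measRelEntropy, basisDivergence]
  congr 1
  · simp
  · simp only [preProcess, effect_ampliate]
    rw [e.sum_comp fun p => relEntropy (kroneckerMap (· * ·) (effect E p.1) (single p.2 p.2 1))
      (kroneckerMap (· * ·) (effect F p.1) (single p.2 p.2 1)), Fintype.sum_prod_type]
    refine Finset.sum_congr rfl fun i _ => ?_
    rw [Fintype.sum_unique]
    simp only [hF.effect_eq]
    exact relEntropy_kronecker (hE.effect_posSemidef i) _ _

theorem exists_measDivergence_eq (E F : SuperOp A A) (hE : IsChannel E) (hF : IsDIO F) :
    ∃ (k n : ℕ) (M : Fin n → Matrix (A × Fin (k + 1)) (A × Fin (k + 1)) ℂ),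
      IsIncoherentMeasurement M ∧ measDivergence M E F = basisDivergence E F :=
  let e := (Fintype.equivFin (A × Fin (0 + 1))).symm
  ⟨0, _, _, isIncoherentMeasurement_single e, measDivergence_single (R := Fin 1) hE hF e⟩

/-- The optimal measurement is the measurement in the incoherent basis, without ancilla. -/
theorem maxDivergence_eq [Nonempty A] {E F : SuperOp A A} (hE : IsChannel E) (hF : IsDIO F) :
    maxDivergence E F = basisDivergence E F := by
  refine le_antisymm ?_ ?_
  · exact iSup_le fun k => iSup_le fun n => iSup_le fun M => iSup_le fun hM =>
      measDivergence_le hE hF hM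
  · obtain ⟨k, n, M, hM, h⟩ := exists_measDivergence_eq E F hE hF
    rw [← h]
    exact le_iSup_of_le k (le_iSup_of_le n (le_iSup_of_le M (le_iSup_of_le hM le_rfl)))

/-! ### Closed form of the cohering power and its properties -/

/-- The closed form `(1/d) ∑ i, D(E†(|i⟩⟨i|)‖Δ(E†(|i⟩⟨i|)))` of the cohering power. -/
def closedForm (E : SuperOp A A) : ℝ :=
  1 / (Fintype.card A : ℝ) * ∑ i, relDiag (effect E i) (transition E i)

theorem IsChannel.transition_eq_zero {E : SuperOp A A} (hE : IsChannel E) {i j : A}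
    (h : transition E i j = 0) : effect E i j j = 0 := by
  rw [hE.effect_diag, h, Complex.ofReal_zero]

/-- Among all stochastic matrices, the transition matrix of `E` itself minimises the divergence. -/
theorem closedForm_le {E : SuperOp A A} (hE : IsChannel E) {f : A → A → ℝ}
    (hf : ∀ i j, 0 ≤ f i j) (hs : ∀ j, ∑ i, f i j = 1)
    (hac : ∀ i j, f i j = 0 → effect E i j j = 0) :
    closedForm E ≤ 1 / (Fintype.card A : ℝ) * ∑ i, relDiag (effect E i) (f i) := by
  refine mul_le_mul_of_nonneg_left ?_ (by positivity)
  simp only [relDiag, Finset.sum_sub_distrib]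
  refine sub_le_sub_left ?_ _
  -- The entropy terms agree on both sides. The sums are exchanged because normalisation holds along
  -- columns: for fixed $j$, both matrices sum to one over $i$.
  rw [Finset.sum_comm, Finset.sum_comm (f := fun i j => _ * Real.log (transition E i j))]
  refine Finset.sum_le_sum fun j _ => ?_
  simp only [hE.effect_diag, Complex.ofReal_re]
  refine sum_mul_log_le (fun i => hE.transition_nonneg i j) (fun i => hf i j) (fun i h => ?_)
    ((hs j).trans (hE.sum_transition j).symm)
  have := hac i j h
  rw [hE.effect_diag] at this
  exact_mod_cast this

theorem maxDivergence_dephased [Nonempty A] {E : SuperOp A A} (hE : IsChannel E) :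
    maxDivergence E (dephased E) = (closedForm E : EReal) := by
  have ht : transition (dephased E) = transition E := by
    ext i j; exact transition_dephased E i j
  rw [maxDivergence_eq hE (isDIO_dephased hE),
    basisDivergence_eq_coe hE (isDIO_dephased hE) fun i j h => hE.transition_eq_zero (by rwa [← ht]),
    ht, closedForm]

theorem coheringPower_eq [Nonempty A] {E : SuperOp A A} (hE : IsChannel E) :
    coheringPower E = (closedForm E : EReal) := by
  refine le_antisymm ?_ (le_iInf fun F => le_iInf fun hF => ?_)
  · rw [← maxDivergence_dephased hE]
    exact iInf_le_of_le _ (iInf_le_of_le (isDIO_dephased hE) le_rfl)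
  · rw [maxDivergence_eq hE hF]
    by_cases h : Dominates F E
    · rw [basisDivergence_eq_coe hE hF h]
      exact EReal.coe_le_coe_iff.2
        (closedForm_le hE hF.1.transition_nonneg hF.1.sum_transition h)
    · rw [basisDivergence_eq_top hE hF h]
      exact le_top

theorem IsChannel.transition_eq_re {E : SuperOp A A} (hE : IsChannel E) (i : A) :
    transition E i = fun j => (effect E i j j).re := by
  ext j; rw [hE.effect_diag, Complex.ofReal_re]

theorem IsChannel.relDiag_nonneg {E : SuperOp A A} (hE : IsChannel E) (i : A) :
    0 ≤ relDiag (effect E i) (transition E i) := by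
  rw [hE.transition_eq_re]
  exact relDiag_diag_nonneg (hE.effect_posSemidef i)

theorem closedForm_nonneg {E : SuperOp A A} (hE : IsChannel E) : 0 ≤ closedForm E :=
  mul_nonneg (by positivity) (Finset.sum_nonneg fun i _ => hE.relDiag_nonneg i)

theorem closedForm_eq_zero_iff [Nonempty A] {E : SuperOp A A} (hE : IsChannel E) :
    closedForm E = 0 ↔ IsDIO E := by
  have hd : (1 / (Fintype.card A : ℝ)) ≠ 0 := by positivity
  rw [isDIO_iff_isDiag_effect hE, closedForm, mul_eq_zero, or_iff_right hd,
    Finset.sum_eq_zero_iff_of_nonneg fun i _ => hE.relDiag_nonneg i]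
  refine forall_congr' fun i => ?_
  simp only [Finset.mem_univ, true_imp_iff, hE.transition_eq_re]
  exact ⟨isDiag_of_relDiag_diag_eq_zero (hE.effect_posSemidef i),
    relDiag_diag_eq_zero_of_isDiag (hE.effect_posSemidef i)⟩

/-- Effects and transition probabilities are both linear in the channel, so joint convexity applies
outcome by outcome. -/
theorem closedForm_convex {E G : SuperOp A A} (hE : IsChannel E) (hG : IsChannel G) {p : ℝ}
    (h0 : 0 ≤ p) (h1 : p ≤ 1) :
    closedForm ((p : ℂ) • E + ((1 - p : ℝ) : ℂ) • G) ≤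
      p * closedForm E + (1 - p) * closedForm G := by
  have key : ∀ i, relDiag (effect ((p : ℂ) • E + ((1 - p : ℝ) : ℂ) • G) i)
      (transition ((p : ℂ) • E + ((1 - p : ℝ) : ℂ) • G) i) ≤
      p * relDiag (effect E i) (transition E i) +
        (1 - p) * relDiag (effect G i) (transition G i) := by
    intro i
    have := relDiag_sum_le (X := ![effect E i, effect G i]) (y := ![transition E i, transition G i])
      (m := ![p, 1 - p])
      (Fin.forall_fin_two.2 ⟨hE.effect_posSemidef i, hG.effect_posSemidef i⟩)
      (Fin.forall_fin_two.2 ⟨hE.transition_nonneg i, hG.transition_nonneg i⟩)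
      (Fin.forall_fin_two.2 ⟨fun j h => hE.transition_eq_zero h, fun j h => hG.transition_eq_zero h⟩)
      (Fin.forall_fin_two.2 ⟨h0, sub_nonneg.2 h1⟩)
    simp only [Fin.sum_univ_two, cons_val_zero, cons_val_one] at this
    convert this using 2
    · ext j k
      simp only [effect_apply, LinearMap.add_apply, LinearMap.smul_apply, Matrix.add_apply,
        Matrix.smul_apply]
    · ext j
      simp only [transition, LinearMap.add_apply, LinearMap.smul_apply, Matrix.add_apply,
        Matrix.smul_apply, Complex.add_re, smul_eq_mul, Complex.re_ofReal_mul]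
  calc closedForm _ ≤ 1 / (Fintype.card A : ℝ) * ∑ i, (p * relDiag (effect E i) (transition E i) +
        (1 - p) * relDiag (effect G i) (transition G i)) :=
        mul_le_mul_of_nonneg_left (Finset.sum_le_sum fun i _ => key i) (by positivity)
    _ = _ := by
        rw [Finset.sum_add_distrib, ← Finset.mul_sum, ← Finset.mul_sum, closedForm, closedForm]
        ring

theorem closedForm_comp_le {E K L : SuperOp A A} (hE : IsChannel E) (hK : IsDIO K)
    (hL : IsDIO L) (hu : IsUnital L) : closedForm (K ∘ₗ E ∘ₗ L) ≤ closedForm E := by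
  have heff : ∀ i, effect (K ∘ₗ E ∘ₗ L) i =
      ∑ j, (transition K i j : ℂ) • dual L (effect E j) := by
    intro i
    rw [effect, dual_comp, dual_comp, ← effect, hK.effect_eq, diagonal_eq_sum_single, map_sum,
      map_sum]
    exact Finset.sum_congr rfl fun j _ => by rw [map_smul, map_smul]; rfl
  have hX : ∀ j, (dual L (effect E j)).PosSemidef := fun j =>
    hL.1.1.dual_posSemidef (hE.effect_posSemidef j)
  have hy : ∀ j a, 0 ≤ ∑ b, transition E j b * transition L b a := fun j a =>
    Finset.sum_nonneg fun b _ => mul_nonneg (hE.transition_nonneg j b) (hL.1.transition_nonneg b a)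
  have hdp := fun j => relDiag_dual_le hL hu (hE.effect_posSemidef j) (hE.transition_nonneg j)
    fun a h => hE.transition_eq_zero h
  have hk := hK.1.transition_nonneg
  -- The product $f$ of the three transition matrices need not be the transition matrix of the
  -- composite, since $E$ may detect coherence created by $L$. As a stochastic competitor in
  -- `closedForm_le` it still gives an upper bound, and it is the matrix that data processing and
  -- convexity produce.
  refine (closedForm_le (hK.1.comp (hE.comp hL.1))
    (f := fun i a => ∑ j, transition K i j * ∑ b, transition E j b * transition L b a)
    (fun i a => Finset.sum_nonneg fun j _ => mul_nonneg (hk i j) (hy j a)) (fun a => ?_)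
    fun i a h => ?_).trans (mul_le_mul_of_nonneg_left ?_ (by positivity))
  · rw [Finset.sum_comm]
    simp only [← Finset.sum_mul, hK.1.sum_transition, one_mul]
    rw [Finset.sum_comm]
    simp only [← Finset.sum_mul, hE.sum_transition, one_mul, hL.1.sum_transition]
  · rw [heff]
    exact sum_smul_apply_eq_zero (hk i) hy (fun j => (hdp j).1) a h
  · calc _ ≤ ∑ i, ∑ j, transition K i j * relDiag (effect E j) (transition E j) :=
          Finset.sum_le_sum fun i _ => by
            rw [heff]
            exact (relDiag_sum_le hX hy (fun j => (hdp j).1) (hk i)).trans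
              (Finset.sum_le_sum fun j _ => mul_le_mul_of_nonneg_left (hdp j).2 (hk i j))
      _ = _ := by
          rw [Finset.sum_comm]
          simp only [← Finset.sum_mul, hK.1.sum_transition, one_mul]

end MeasurementCohering

end

theorem mainTheorem9 {A : Type*} [Fintype A] [DecidableEq A] [Nonempty A] :
    -- the minimum and the maxima in the definition are attained, and the power is finite
    (∀ E : MeasurementCohering.SuperOp A A, MeasurementCohering.IsChannel E →
      (∃ F, MeasurementCohering.IsDIO F ∧
        MeasurementCohering.maxDivergence E F = MeasurementCohering.coheringPower E) ∧
      (∀ F, MeasurementCohering.IsDIO F →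
        ∃ (k n : ℕ) (M : Fin n → Matrix (A × Fin (k + 1)) (A × Fin (k + 1)) ℂ),
          MeasurementCohering.IsIncoherentMeasurement M ∧
          MeasurementCohering.measDivergence M E F = MeasurementCohering.maxDivergence E F) ∧
      MeasurementCohering.coheringPower E ≠ ⊤) ∧
    -- non-negativity and faithfulness
    (∀ E : MeasurementCohering.SuperOp A A, MeasurementCohering.IsChannel E →
      0 ≤ MeasurementCohering.coheringPower E ∧
      (MeasurementCohering.coheringPower E = 0 ↔ MeasurementCohering.IsDIO E)) ∧
    -- monotonicity
    (∀ E K L : MeasurementCohering.SuperOp A A, MeasurementCohering.IsChannel E →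
      MeasurementCohering.IsDIO K → MeasurementCohering.IsDIO L →
      MeasurementCohering.IsUnital L →
      MeasurementCohering.coheringPower (K ∘ₗ E ∘ₗ L) ≤ MeasurementCohering.coheringPower E) ∧
    -- convexity
    (∀ E G : MeasurementCohering.SuperOp A A, MeasurementCohering.IsChannel E →
      MeasurementCohering.IsChannel G → ∀ p : ℝ, 0 ≤ p → p ≤ 1 →
      MeasurementCohering.coheringPower ((p : ℂ) • E + ((1 - p : ℝ) : ℂ) • G) ≤
        (p : EReal) * MeasurementCohering.coheringPower E +
          ((1 - p : ℝ) : EReal) * MeasurementCohering.coheringPower G) := by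
  open MeasurementCohering in
  refine ⟨fun E hE => ⟨⟨dephased E, isDIO_dephased hE, ?_⟩, fun F hF => ?_, ?_⟩,
    fun E hE => ⟨?_, ?_⟩, fun E K L hE hK hL hu => ?_, fun E G hE hG p h0 h1 => ?_⟩
  · rw [maxDivergence_dephased hE, coheringPower_eq hE]
  · rw [maxDivergence_eq hE hF]
    exact exists_measDivergence_eq E F hE hF
  · rw [coheringPower_eq hE]
    exact EReal.coe_ne_top _
  · rw [coheringPower_eq hE]
    exact EReal.coe_nonneg.2 (closedForm_nonneg hE)
  · rw [coheringPower_eq hE, EReal.coe_eq_zero]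
    exact closedForm_eq_zero_iff hE
  · rw [coheringPower_eq hE, coheringPower_eq (hK.1.comp (hE.comp hL.1))]
    exact EReal.coe_le_coe_iff.2 (closedForm_comp_le hE hK hL hu)
  · rw [coheringPower_eq (hE.convex hG h0 h1), coheringPower_eq hE, coheringPower_eq hG,
      ← EReal.coe_mul, ← EReal.coe_mul, ← EReal.coe_add]
    exact EReal.coe_le_coe_iff.2 (closedForm_convex hE hG h0 h1)
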